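/- For a positive integer $n$ let $\Omega(n)$ denote the number of prime factors of $n$, counted with multiplicity (so $\Omega(1)=0$). (1) Let $a:\mathbb{N}_0\to\mathbb{C}$ be bounded, where $\mathbb{N}_0=\{0,1,2,\dots\}$, and suppose that its Cesàro averages over intervals converge to zero uniformly in the starting point, that is, $$\lim_{K\to\infty}\ \sup_{M\ge 0}\ \Big|\frac1K\sum_{k=M+1}^{M+K}a(k)\Big|=0 .$$ Then $$\lim_{N\to\infty}\frac1N\sum_{n=1}^{N}a(\Omega(n))=0 .$$ (2) Consequently, let $X$ be a compact metric space with its Borel $\sigma$-algebra, $\mu$ a Borel probability measure on $X$, and $T:X\to X$ a measure-preserving transformation that is ergodic with respect to $\mu$. If $f:X\to\mathbb{C}$ is a function such that $\frac1N\sum_{n=1}^{N}f(T^nx)\to 0$ as $N\to\infty$ uniformly in $x\in X$, then for every $x\in X$ $$\lim_{N\to\infty}\frac1N\sum_{n=1}^{N}f(T^{\Omega(n)}x)=0 .$$ -/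

import Mathlib

open Filter Topology MeasureTheory

section

open scoped FourierTransform ContDiff SchwartzMap
open ArithmeticFunction

/-! Put `expMean a u` for the mean of a(Ω(n)) over n ≤ e^u, and take limits G(s) of `expMean a (u +
s)` along an ultrafilter in u finer than `atTop`. It suffices to show that every such limit vanishes
at s = 0. Boundedness of a makes G bounded and Lipschitz.

Since Ω(pm) = Ω(m) + 1, multiples of p carry the limit G' attached to the shifted sequence a(k + 1),
at scale s - log p. A Turán–Kubilius argument then shows that, for weights c ≥ 0 on primes with ∑
c(p)/p ≥ 1/2 and ∑ c(p)²/p ≤ ε, the c(p)/p-weighted sum of G(s) - G'(s - log p) is O(√ε).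

The weights can also be chosen so that the masses c(p)/p at log p are almost invariant under a
prescribed translation, when tested against a given bounded Lipschitz function
(`exists_prime_weights`). Comparing the scales s and t gives G(s) = G(t) (`limit_expMean_eq`). Then
G' is constant too, and the same inequality gives G = G' (`limit_expMean_shift_eq`). So the limits
for all shifts of a agree, and their average over K shifts is the limit for the interval averages of
a, which are uniformly small.

Almost invariance comes from the masses σΛ(n)n^(-1-σ) at log n as σ → 0+. Their Fourier transforms
are values of -ζ'/ζ near Re s = 1. A translation difference introduces a factor vanishing at
frequency 0, which cancels the only pole, and the Riemann–Lebesgue lemma disposes of the rest.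

Part (2) is part (1) applied to a(n) = f(T^n x). Uniformity in the point of X gives uniformity in
the starting index, as well as boundedness of a. -/

theorem exists_continuousOn_LSeries_vonMangoldt :
    ∃ h : ℂ → ℂ, ContinuousOn h {s | 1 ≤ s.re} ∧
      ∀ s : ℂ, 1 < s.re → LSeries (fun n => (vonMangoldt n : ℂ)) s = h s + 1 / (s - 1) := by
  -- Modulo 1 every integer lies in the class of 1, so the residue-class function specialises to Λ.
  -- Its continuity up to Re s = 1 encodes the nonvanishing of ζ on that line.
  refine ⟨vonMangoldt.LFunctionResidueClassAux (1 : ZMod 1),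
    vonMangoldt.continuousOn_LFunctionResidueClassAux _, fun s hs => ?_⟩
  rw [vonMangoldt.eqOn_LFunctionResidueClassAux isUnit_one hs]
  have : ∀ n : ℕ, vonMangoldt.residueClass (1 : ZMod 1) n = vonMangoldt n := fun n => by
    simp [vonMangoldt.residueClass, Subsingleton.elim (n : ZMod 1) 1]
  simp [this]

/-! ### Fourier analysis on the line -/

theorem Real.continuous_fourier {f : ℝ → ℂ} (hf : Integrable f) : Continuous (𝓕 f) :=
  VectorFourier.fourierIntegral_continuous Real.continuous_fourierChar
    continuous_inner hf

theorem Real.norm_fourier_le (f : ℝ → ℂ) (w : ℝ) : ‖𝓕 f w‖ ≤ ∫ v, ‖f v‖ :=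
  VectorFourier.norm_fourierIntegral_le_integral_norm _ _ _ _ _

theorem Real.fourier_sub_apply {f g : ℝ → ℂ} (hf : Integrable f) (hg : Integrable g) (x : ℝ) :
    𝓕 (fun t => f t - g t) x = 𝓕 f x - 𝓕 g x := by
  simp only [Real.fourier_real_eq, smul_sub]
  exact integral_sub ((Real.fourierIntegral_convergent_iff x).2 hf |>.congr (by simp [mul_comm]))
    ((Real.fourierIntegral_convergent_iff x).2 hg |>.congr (by simp [mul_comm]))

theorem mul_integral_exp_neg_mul_abs {σ : ℝ} (hσ : 0 < σ) :
    σ * ∫ x : ℝ, Real.exp (-(σ * |x|)) = 2 := by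
  rw [integral_comp_abs (f := fun x => Real.exp (-(σ * x)))]
  have h2 := integral_exp_mul_Ioi (a := -σ) (by linarith) 0
  simp only [neg_mul, mul_zero, Real.exp_zero] at h2
  rw [h2]
  field_simp

theorem integrable_exp_neg_mul_abs {σ : ℝ} (hσ : 0 < σ) :
    Integrable (fun x : ℝ => Real.exp (-(σ * |x|))) := by
  refine Integrable.of_integral_ne_zero fun h => ?_
  have := mul_integral_exp_neg_mul_abs hσ
  rw [h] at this
  norm_num at this

theorem integrable_exp_neg_abs : Integrable (fun x : ℝ => Real.exp (-|x|)) := by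
  simpa using integrable_exp_neg_mul_abs one_pos

/-- A continuous function vanishing at infinity has vanishing exponentially weighted means. -/
theorem tendsto_mul_integral_exp_neg_mul_abs {k : ℝ → ℝ} (hk : Continuous k)
    (h0 : Tendsto k (cocompact ℝ) (𝓝 0)) {B : ℝ} (hB : ∀ x, ‖k x‖ ≤ B) :
    Tendsto (fun σ : ℝ => σ * ∫ v, Real.exp (-(σ * |v|)) * k v) (𝓝[>] 0) (𝓝 0) := by
  -- Substituting x = σv fixes the weight and sends the argument of k to infinity for every x ≠ 0.
  have h1 : Tendsto (fun σ : ℝ => ∫ x, Real.exp (-|x|) * k (σ⁻¹ * x)) (𝓝[>] 0) (𝓝 0) := by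
    have : (0 : ℝ) = ∫ x : ℝ, (0 : ℝ) := by simp
    rw [this]
    refine tendsto_integral_filter_of_dominated_convergence (fun x => Real.exp (-|x|) * B) ?_ ?_
      (integrable_exp_neg_abs.mul_const B) ?_
    · filter_upwards with σ
      exact Continuous.aestronglyMeasurable (by fun_prop)
    · filter_upwards with σ
      filter_upwards with x
      rw [norm_mul, Real.norm_eq_abs, abs_of_pos (Real.exp_pos _)]
      gcongr
      exact hB _
    · have : ∀ᵐ x : ℝ, x ≠ 0 := by simp [ae_iff]
      filter_upwards [this] with x hx
      have h2 : Tendsto (fun σ : ℝ => σ⁻¹ * x) (𝓝[>] 0) (cocompact ℝ) := by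
        rw [← Metric.cobounded_eq_cocompact, ← tendsto_norm_atTop_iff_cobounded]
        simp only [norm_mul]
        exact (tendsto_norm_atTop_atTop.comp tendsto_inv_nhdsGT_zero).atTop_mul_const (by simpa using hx)
      simpa using (h0.comp h2).const_mul (Real.exp (-|x|))
  refine h1.congr' ?_
  filter_upwards [self_mem_nhdsWithin] with σ hσ
  have hσ : (0 : ℝ) < σ := hσ
  have := Measure.integral_comp_mul_left (fun x => Real.exp (-|x|) * k (σ⁻¹ * x)) σ
  have h3 : (fun x => Real.exp (-|σ * x|) * k (σ⁻¹ * (σ * x))) =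
      fun v => Real.exp (-(σ * |v|)) * k v := by
    ext x
    rw [inv_mul_cancel_left₀ hσ.ne', abs_mul, abs_of_pos hσ]
  rw [h3] at this
  rw [this, abs_of_pos (inv_pos.2 hσ), smul_eq_mul, mul_inv_cancel_left₀ hσ.ne']

/-- A uniform Riemann–Lebesgue lemma in mean for an `L¹`-convergent family. -/
theorem tendsto_mul_integral_exp_mul_norm_fourier {Q : ℝ → ℝ → ℂ}
    (hQ : ∀ σ, 0 ≤ σ → Integrable (Q σ))
    (hlim : Tendsto (fun σ => ∫ t, ‖Q σ t - Q 0 t‖) (𝓝[>] 0) (𝓝 0)) :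
    Tendsto (fun σ : ℝ => σ * ∫ v, Real.exp (-(σ * |v|)) * ‖𝓕 (Q σ) (-v)‖) (𝓝[>] 0) (𝓝 0) := by
  have hneg : Tendsto (fun v : ℝ => ‖𝓕 (Q 0) (-v)‖) (cocompact ℝ) (𝓝 0) := by
    have h := ((Real.zero_at_infty_fourier (Q 0)).comp
      (Homeomorph.neg ℝ).isClosedEmbedding.tendsto_cocompact).norm
    simpa using h
  have h0 := tendsto_mul_integral_exp_neg_mul_abs (k := fun v => ‖𝓕 (Q 0) (-v)‖)
    ((Real.continuous_fourier (hQ 0 le_rfl)).comp continuous_neg).norm hneg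
    (B := ∫ t, ‖Q 0 t‖) (fun x => by simpa using Real.norm_fourier_le (Q 0) (-x))
  have hsum := (hlim.const_mul 2).add h0
  simp only [mul_zero, add_zero] at hsum
  refine squeeze_zero' ?_ ?_ hsum
  · filter_upwards [self_mem_nhdsWithin] with σ hσ
    exact mul_nonneg (le_of_lt hσ) (integral_nonneg fun v => by positivity)
  · filter_upwards [self_mem_nhdsWithin] with σ hσ
    have hσ : (0 : ℝ) < σ := hσ
    have hint : ∀ τ : ℝ, 0 ≤ τ →
        Integrable (fun v : ℝ => Real.exp (-(σ * |v|)) * ‖𝓕 (Q τ) (-v)‖) := fun τ hτ => by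
      refine (integrable_exp_neg_mul_abs hσ).mul_bdd (c := ∫ t, ‖Q τ t‖) ?_ ?_
      · exact (((Real.continuous_fourier (hQ τ hτ)).comp
          continuous_neg).norm).aestronglyMeasurable
      · filter_upwards with v
        simpa using Real.norm_fourier_le (Q τ) (-v)
    -- The transform of Q σ - Q 0 is bounded uniformly in v by the L¹ distance, and the weight has
    -- total mass 2/σ. Only the fixed function Q 0 needs Riemann–Lebesgue.
    have key : ∫ v, Real.exp (-(σ * |v|)) * ‖𝓕 (Q σ) (-v)‖ ≤
        ∫ v, (Real.exp (-(σ * |v|)) * (∫ t, ‖Q σ t - Q 0 t‖) +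
          Real.exp (-(σ * |v|)) * ‖𝓕 (Q 0) (-v)‖) := by
      refine integral_mono (hint σ hσ.le)
        (((integrable_exp_neg_mul_abs hσ).mul_const _).add (hint 0 le_rfl)) fun v => ?_
      dsimp only
      rw [← mul_add]
      gcongr
      have h1 := Real.norm_fourier_le (fun t => Q σ t - Q 0 t) (-v)
      rw [Real.fourier_sub_apply (hQ σ hσ.le) (hQ 0 le_rfl)] at h1
      calc ‖𝓕 (Q σ) (-v)‖ = ‖(𝓕 (Q σ) (-v) - 𝓕 (Q 0) (-v)) + 𝓕 (Q 0) (-v)‖ := by simp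
        _ ≤ _ := (norm_add_le _ _).trans (by gcongr)
    rw [integral_add ((integrable_exp_neg_mul_abs hσ).mul_const _) (hint 0 le_rfl),
      integral_mul_const] at key
    calc _ ≤ σ * _ := mul_le_mul_of_nonneg_left key hσ.le
      _ = (σ * ∫ v : ℝ, Real.exp (-(σ * |v|))) * (∫ t, ‖Q σ t - Q 0 t‖) +
          σ * ∫ v, Real.exp (-(σ * |v|)) * ‖𝓕 (Q 0) (-v)‖ := by ring
      _ = _ := by rw [mul_integral_exp_neg_mul_abs hσ]

/-- Sums of a Fourier transform along points against summable weights. -/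
theorem tsum_mul_fourier {w : ℕ → ℂ} (hw : Summable (‖w ·‖)) (ν : ℕ → ℝ) {ψ : ℝ → ℂ}
    (hψ : Integrable ψ) (v : ℝ) :
    ∑' n, w n * 𝓕 ψ (ν n - v) =
      𝓕 (fun t => ψ t * ∑' n, w n * (𝐞 (-(t * ν n)) : ℂ)) (-v) := by
  have hint : ∀ n, Integrable (fun t => w n * ((𝐞 (-(t * (ν n - v))) : ℂ) * ψ t)) := fun n => by
    have := (Real.fourierIntegral_convergent_iff (ν n - v)).2 hψ
    refine Integrable.const_mul (this.congr ?_) _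
    simp [Circle.smul_def, mul_comm]
  have hsum := integral_tsum_of_summable_integral_norm hint (by
    simp only [norm_mul, Circle.norm_coe, one_mul, integral_const_mul]
    exact hw.mul_right _)
  simp only [Real.fourier_real_eq, Circle.smul_def, smul_eq_mul]
  simp only [integral_const_mul] at hsum
  rw [hsum]
  congr 1
  ext t
  rw [← tsum_mul_left, ← tsum_mul_left]
  congr 1
  ext n
  have : (𝐞 (-(t * (ν n - v))) : ℂ) = 𝐞 (-(t * -v)) * 𝐞 (-(t * ν n)) := by
    rw [← Circle.coe_mul, ← AddChar.map_add_eq_mul]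
    congr 2
    ring
  rw [this]
  ring

/-- Fubini for a function smoothed by 𝓕 ψ and summed against weights: the weights then enter only
through their exponential sum, which for the von Mangoldt weights is an L-series. -/
theorem tsum_mul_integral_mul_fourier {w : ℕ → ℂ} (hw : Summable (‖w ·‖)) (ν : ℕ → ℝ)
    {ψ f : ℝ → ℂ} (hψ : Integrable ψ) (hf : Integrable f) :
    ∑' n, w n * ∫ v, f v * 𝓕 ψ (ν n - v) =
      ∫ v, f v * 𝓕 (fun t => ψ t * ∑' n, w n * (𝐞 (-(t * ν n)) : ℂ)) (-v) := by
  have hb : ∀ n, Integrable (fun v => f v * 𝓕 ψ (ν n - v)) := fun n =>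
    hf.mul_bdd (c := ∫ t, ‖ψ t‖)
      ((Real.continuous_fourier hψ).comp (continuous_const.sub continuous_id)).aestronglyMeasurable
      (by filter_upwards with v using Real.norm_fourier_le _ _)
  have hsum := integral_tsum_of_summable_integral_norm (fun n => (hb n).const_mul (w n)) (by
    refine Summable.of_nonneg_of_le (fun n => integral_nonneg fun v => norm_nonneg _) (fun n => ?_)
      (hw.mul_right ((∫ v, ‖f v‖) * ∫ t, ‖ψ t‖))
    simp only [norm_mul, integral_const_mul]
    gcongr
    rw [← integral_mul_const]
    refine integral_mono ((hb n).norm.congr (by simp)) (hf.norm.mul_const _) fun v => ?_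
    dsimp only
    gcongr
    exact Real.norm_fourier_le _ _)
  simp only [integral_const_mul] at hsum
  rw [hsum]
  congr 1
  ext v
  rw [← tsum_mul_fourier hw ν hψ v, ← tsum_mul_left]
  congr 1
  ext n
  ring

/-- Smooth approximate identities with compactly supported Fourier transform. -/
theorem exists_bandlimited_kernel {ε : ℝ} (hε : 0 < ε) :
    ∃ ψ : ℝ → ℂ, Continuous ψ ∧ HasCompactSupport ψ ∧ Integrable (𝓕 ψ) ∧ ∫ x, 𝓕 ψ x = 1 ∧
      Integrable (fun x => |x| * ‖𝓕 ψ x‖) ∧ ∫ x, |x| * ‖𝓕 ψ x‖ ≤ ε := by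
  obtain ⟨φ₀, -, hcs, hsm, -, h1⟩ :=
    exists_contDiff_tsupport_subset (n := ⊤) (univ_mem : (Set.univ : Set ℝ) ∈ 𝓝 0)
  have hcs' : HasCompactSupport (fun t => (φ₀ t : ℂ)) := hcs.comp_left Complex.ofReal_zero
  have hsm' : ContDiff ℝ ∞ (fun t => (φ₀ t : ℂ)) := Complex.ofRealCLM.contDiff.comp hsm
  let φ : 𝓢(ℝ, ℂ) := hcs'.toSchwartzMap hsm'
  have hφ0 : φ 0 = 1 := by simp [φ, h1]
  have hφc : HasCompactSupport φ := hcs'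
  set A := ∫ x, |x| * ‖𝓕 φ x‖ with hA
  have hA0 : 0 ≤ A := integral_nonneg fun x => by positivity
  have hAint : Integrable (fun x => |x| * ‖𝓕 φ x‖) := by
    have h := (𝓕 φ).integrable_pow_mul volume 1
    simp only [pow_one, Real.norm_eq_abs] at h
    exact h
  -- Fourier inversion at 0.
  have hint1 : ∫ x, 𝓕 φ x = 1 := by
    have h := congrFun (φ.continuous.fourierInv_fourier_eq φ.integrable
      (by rw [← SchwartzMap.fourier_coe]; exact (𝓕 φ).integrable)) 0
    rw [Real.fourierInv_eq, hφ0] at h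
    simpa [SchwartzMap.fourier_coe] using h
  -- Concentrating the kernel by a factor R keeps its mass and divides its first absolute moment A
  -- by R.
  obtain ⟨R, hR, hRA⟩ : ∃ R : ℝ, 0 < R ∧ R⁻¹ * A ≤ ε := by
    refine ⟨(A + 1) / ε, by positivity, ?_⟩
    rw [inv_div, div_mul_eq_mul_div, div_le_iff₀ (by positivity)]
    nlinarith
  have hscale : ∀ x, 𝓕 (fun t => φ (R⁻¹ * t)) x = R * 𝓕 φ (R * x) := fun x => by
    rw [SchwartzMap.fourier_coe, Real.fourier_real_eq, Real.fourier_real_eq]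
    have := Measure.integral_comp_mul_left (fun s => 𝐞 (-(s * (R * x))) • φ s) R⁻¹
    rw [inv_inv, abs_of_pos hR, Complex.real_smul] at this
    rw [← this]
    congr 1
    ext t
    congr 3
    field_simp
  have hfun : 𝓕 (fun t => φ (R⁻¹ * t)) = fun x => R * 𝓕 φ (R * x) := funext hscale
  have habs : (fun x => |x| * ‖(R : ℂ) * 𝓕 φ (R * x)‖) =
      fun x => |R * x| * ‖𝓕 φ (R * x)‖ := by
    ext x
    rw [norm_mul, Complex.norm_real, Real.norm_eq_abs, abs_mul]
    ring
  refine ⟨fun t => φ (R⁻¹ * t), by fun_prop, ?_, ?_, ?_, ?_, ?_⟩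
  · exact hφc.comp_homeomorph (Homeomorph.mulLeft₀ R⁻¹ (inv_ne_zero hR.ne'))
  · rw [hfun]
    exact ((𝓕 φ).integrable.comp_mul_left' hR.ne').const_mul _
  · rw [hfun, integral_const_mul, Measure.integral_comp_mul_left (fun x => 𝓕 φ x) R, hint1,
      abs_of_pos (inv_pos.2 hR)]
    simp [hR.ne']
  · rw [hfun, habs]
    exact hAint.comp_mul_left' hR.ne'
  · rw [hfun, habs, Measure.integral_comp_mul_left (fun x => |x| * ‖𝓕 φ x‖) R,
      abs_of_pos (inv_pos.2 hR)]
    exact hRA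

/-- Smoothing a Lipschitz function by a kernel of mass one. -/
theorem norm_sub_integral_mul_kernel_le {f K : ℝ → ℂ} {L C : ℝ} (hL : ∀ x y, ‖f x - f y‖ ≤ L * |x - y|)
    (hC : ∀ x, ‖f x‖ ≤ C) (hf : Continuous f)
    (hK : Integrable K) (hK1 : ∫ x, K x = 1) (hKx : Integrable (fun x => |x| * ‖K x‖)) (u : ℝ) :
    ‖f u - ∫ v, f v * K (u - v)‖ ≤ L * ∫ x, |x| * ‖K x‖ := by
  have h1 : ∫ v, f v * K (u - v) = ∫ x, f (u - x) * K x := by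
    rw [← integral_sub_left_eq_self (fun x => f (u - x) * K x) volume u]
    simp
  have h2 : f u = ∫ x, f u * K x := by rw [integral_const_mul, hK1, mul_one]
  have h3 : Integrable (fun x => f (u - x) * K x) :=
    hK.bdd_mul (c := C) (by fun_prop) (by filter_upwards with x using hC _)
  rw [h1]
  nth_rw 1 [h2]
  rw [← integral_sub (hK.const_mul _) h3, ← integral_const_mul]
  refine norm_integral_le_of_norm_le (hKx.const_mul L) ?_
  filter_upwards with x
  rw [← sub_mul, norm_mul, ← mul_assoc]
  gcongr
  simpa using hL u (u - x)

/-! ### Von Mangoldt weights and their asymptotic translation invariance -/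

/-- The terms of the Dirichlet series of `Λ` at `1 + σ`. -/
noncomputable def vonMangoldtWeight (σ : ℝ) (n : ℕ) : ℝ := Λ n * (n : ℝ) ^ (-(1 + σ))

theorem vonMangoldtWeight_nonneg (σ : ℝ) (n : ℕ) : 0 ≤ vonMangoldtWeight σ n :=
  mul_nonneg vonMangoldt_nonneg (by positivity)

theorem vonMangoldtWeight_mul_fourierChar (σ t : ℝ) (n : ℕ) :
    (vonMangoldtWeight σ n : ℂ) * (𝐞 (-(t * Real.log n)) : ℂ) =
      LSeries.term (fun n => (Λ n : ℂ)) (1 + σ + 2 * Real.pi * t * Complex.I) n := by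
  rcases eq_or_ne n 0 with rfl | hn
  · simp [vonMangoldtWeight]
  have hn' : (n : ℂ) ≠ 0 := by exact_mod_cast hn
  rw [LSeries.term_of_ne_zero hn, div_eq_mul_inv, ← Complex.cpow_neg, Real.fourierChar_apply,
    vonMangoldtWeight, Complex.ofReal_mul, Complex.ofReal_cpow (by positivity), mul_assoc,
    Complex.ofReal_natCast, Complex.cpow_def_of_ne_zero hn', Complex.cpow_def_of_ne_zero hn',
    ← Complex.exp_add, ← Complex.natCast_log]
  congr 2
  push_cast
  ring

theorem tsum_vonMangoldtWeight_mul_fourierChar (σ t : ℝ) :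
    ∑' n, (vonMangoldtWeight σ n : ℂ) * (𝐞 (-(t * Real.log n)) : ℂ) =
      LSeries (fun n => (Λ n : ℂ)) (1 + σ + 2 * Real.pi * t * Complex.I) :=
  tsum_congr fun n => vonMangoldtWeight_mul_fourierChar σ t n

theorem summable_vonMangoldtWeight {σ : ℝ} (hσ : 0 < σ) : Summable (vonMangoldtWeight σ) := by
  have h : LSeriesSummable (fun n => (Λ n : ℂ)) (1 + σ + 2 * Real.pi * (0 : ℝ) * Complex.I) :=
    LSeriesSummable_vonMangoldt (by simpa using hσ)
  have h2 : Summable fun n => (vonMangoldtWeight σ n : ℂ) := by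
    refine h.congr fun n => ?_
    rw [← vonMangoldtWeight_mul_fourierChar]
    simp
  exact_mod_cast h2

/-- The pole of the L-series at 1 is simple with residue 1. -/
theorem tendsto_mul_tsum_vonMangoldtWeight :
    Tendsto (fun σ => σ * ∑' n, vonMangoldtWeight σ n) (𝓝[>] 0) (𝓝 1) := by
  obtain ⟨h, hc, hh⟩ := exists_continuousOn_LSeries_vonMangoldt
  have h1 : Tendsto (fun σ : ℝ => (σ : ℂ) * h (1 + σ) + 1) (𝓝[>] 0) (𝓝 1) := by
    have hcw : Tendsto (fun σ : ℝ => h (1 + σ)) (𝓝[>] 0) (𝓝 (h 1)) := by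
      refine (hc 1 (by simp)).tendsto.comp (tendsto_nhdsWithin_iff.2 ⟨?_, ?_⟩)
      · have : Continuous (fun σ : ℝ => (1 + σ : ℂ)) := by fun_prop
        simpa using (this.tendsto 0).mono_left nhdsWithin_le_nhds
      · filter_upwards [self_mem_nhdsWithin] with σ hσ
        simpa using le_of_lt (show (0 : ℝ) < σ from hσ)
    have h0 : Tendsto (fun σ : ℝ => (σ : ℂ)) (𝓝[>] 0) (𝓝 0) := by
      simpa using (Complex.continuous_ofReal.tendsto 0).mono_left nhdsWithin_le_nhds
    simpa using (h0.mul hcw).add_const 1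
  have h2 : Tendsto (fun σ : ℝ => ((σ * ∑' n, vonMangoldtWeight σ n : ℝ) : ℂ)) (𝓝[>] 0)
      (𝓝 ((1 : ℝ) : ℂ)) := by
    rw [Complex.ofReal_one]
    refine h1.congr' ?_
    filter_upwards [self_mem_nhdsWithin] with σ hσ
    have hσ : (0 : ℝ) < σ := hσ
    have h3 := tsum_vonMangoldtWeight_mul_fourierChar σ 0
    rw [hh _ (by simpa using hσ)] at h3
    have hσ' : (σ : ℂ) ≠ 0 := by exact_mod_cast hσ.ne'
    simp only [zero_mul, neg_zero, AddChar.map_zero_eq_one, Circle.coe_one, mul_one,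
      Complex.ofReal_zero, mul_zero, add_zero] at h3
    rw [Complex.ofReal_mul, Complex.ofReal_tsum, h3]
    rw [add_sub_cancel_left, mul_add, mul_one_div_cancel hσ']
  exact (Complex.continuous_re.tendsto _).comp h2

theorem abs_exp_neg_mul_abs_sub_le {σ : ℝ} (hσ : 0 ≤ σ) (x y : ℝ) :
    |Real.exp (-(σ * |x|)) - Real.exp (-(σ * |y|))| ≤ σ * |x - y| := by
  have key : ∀ x y : ℝ, Real.exp (-(σ * |x|)) - Real.exp (-(σ * |y|)) ≤ σ * |x - y| := by
    intro x y
    have h1 : Real.exp (-(σ * |x|)) ≤ 1 := Real.exp_le_one_iff.2 (by simp; positivity)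
    have h2 : Real.exp (-(σ * |y|)) = Real.exp (-(σ * |x|)) * Real.exp (σ * |x| - σ * |y|) := by
      rw [← Real.exp_add]; congr 1; ring
    have h3 := Real.add_one_le_exp (σ * |x| - σ * |y|)
    have h4 : σ * |y| - σ * |x| ≤ σ * |x - y| := by
      rw [← mul_sub, abs_sub_comm]
      exact mul_le_mul_of_nonneg_left (abs_sub_abs_le_abs_sub y x) hσ
    have h5 := Real.exp_pos (-(σ * |x|))
    have h6 : 0 ≤ σ * |x - y| := by positivity
    rw [h2]
    nlinarith
  exact abs_sub_le_iff.2 ⟨key x y, by simpa [abs_sub_comm] using key y x⟩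

/-- Damping makes g integrable, and it adds only Cσ to the Lipschitz constant. -/
theorem norm_mul_exp_neg_sub_le {g : ℝ → ℂ} {C L : ℝ} (hC : ∀ x, ‖g x‖ ≤ C)
    (hL : ∀ x y, ‖g x - g y‖ ≤ L * |x - y|) {σ : ℝ} (hσ : 0 ≤ σ) (x y : ℝ) :
    ‖g x * (Real.exp (-(σ * |x|)) : ℂ) - g y * (Real.exp (-(σ * |y|)) : ℂ)‖ ≤
      (L + C * σ) * |x - y| := by
  have h1 : g x * (Real.exp (-(σ * |x|)) : ℂ) - g y * (Real.exp (-(σ * |y|)) : ℂ) =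
      (g x - g y) * (Real.exp (-(σ * |x|)) : ℂ) +
        g y * ((Real.exp (-(σ * |x|)) - Real.exp (-(σ * |y|)) : ℝ) : ℂ) := by
    push_cast; ring
  rw [h1]
  refine (norm_add_le _ _).trans ?_
  rw [norm_mul, norm_mul, Complex.norm_real, Complex.norm_real, Real.norm_eq_abs,
    Real.norm_eq_abs, abs_of_pos (Real.exp_pos _), add_mul, mul_assoc]
  have h2 : Real.exp (-(σ * |x|)) ≤ 1 := Real.exp_le_one_iff.2 (by simp; positivity)
  have hC0 : 0 ≤ C := (norm_nonneg _).trans (hC 0)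
  refine add_le_add ?_ (mul_le_mul (hC y) (abs_exp_neg_mul_abs_sub_le hσ x y) (abs_nonneg _) hC0)
  calc _ ≤ (L * |x - y|) * 1 :=
        mul_le_mul (hL x y) h2 (Real.exp_pos _).le ((norm_nonneg _).trans (hL x y))
    _ = _ := mul_one _

/-- Fourier side of the translation defect of the measures with masses `Λ(n) n^(-1-σ)` at `log n`. -/
theorem tendsto_translation_defect_fourier {ψ : ℝ → ℂ} (hψ : Continuous ψ)
    (hcs : HasCompactSupport ψ) (h : ℝ) :
    Tendsto (fun σ : ℝ => σ * ∫ v, Real.exp (-(σ * |v|)) *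
      ‖𝓕 (fun t => (ψ t * (1 - (𝐞 (-(t * h)) : ℂ))) *
        ∑' n, (vonMangoldtWeight σ n : ℂ) * (𝐞 (-(t * Real.log n)) : ℂ)) (-v)‖)
      (𝓝[>] 0) (𝓝 0) := by
  obtain ⟨H, hc, hH⟩ := exists_continuousOn_LSeries_vonMangoldt
  let Q : ℝ → ℝ → ℂ := fun σ t => (ψ t * (1 - (𝐞 (-(t * h)) : ℂ))) *
    (H (1 + σ + 2 * Real.pi * t * Complex.I) + 1 / (σ + 2 * Real.pi * t * Complex.I))
  obtain ⟨B, hB⟩ := hcs.isCompact.isBounded.exists_norm_le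
  obtain ⟨M, hM⟩ : ∃ M : ℝ, ∀ σ t : ℝ, 0 ≤ σ → σ ≤ 1 → |t| ≤ B →
      ‖H (1 + σ + 2 * Real.pi * t * Complex.I)‖ ≤ M := by
    have hK : IsCompact ((fun p : ℝ × ℝ => (1 + p.1 + 2 * Real.pi * p.2 * Complex.I : ℂ)) ''
        (Set.Icc 0 1 ×ˢ Set.Icc (-B) B)) :=
      (isCompact_Icc.prod isCompact_Icc).image (by fun_prop)
    obtain ⟨M, hM⟩ := hK.exists_bound_of_continuousOn (hc.mono (by
      rintro _ ⟨p, ⟨⟨hp, -⟩, -⟩, rfl⟩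
      simpa using hp))
    exact ⟨M, fun σ t h0 h1 ht => hM _ ⟨(σ, t), ⟨⟨h0, h1⟩, abs_le.1 ht⟩, rfl⟩⟩
  have hHc : ∀ σ : ℝ, 0 ≤ σ →
      Continuous (fun t : ℝ => H (1 + σ + 2 * Real.pi * t * Complex.I)) := fun σ hσ =>
    hc.comp_continuous (by fun_prop) (fun t => by simpa using hσ)
  have hec : Continuous (fun t : ℝ => (𝐞 (-(t * h)) : ℂ)) :=
    continuous_subtype_val.comp (Real.continuous_fourierChar.comp (by fun_prop))
  have hmeas : ∀ σ : ℝ, 0 ≤ σ → AEStronglyMeasurable (Q σ) := fun σ hσ => by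
    refine ((hψ.mul (continuous_const.sub hec)).aestronglyMeasurable).mul
      ((hHc σ hσ).aestronglyMeasurable.add ?_)
    have : Measurable (fun t : ℝ => 1 / ((σ : ℂ) + 2 * Real.pi * t * Complex.I)) := by fun_prop
    exact this.aestronglyMeasurable
  -- The pole cancels uniformly in σ: |1 - 𝐞(-th)| ≤ 2π|t||h|, while |σ + 2πit| ≥ 2π|t|.
  have hbound : ∀ σ t : ℝ, 0 ≤ σ → σ ≤ 1 → ‖Q σ t‖ ≤ ‖ψ t‖ * (2 * M + |h|) := by
    intro σ t h0 h1
    by_cases ht : ψ t = 0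
    · simp [Q, ht]
    have htB : |t| ≤ B := hB t (subset_tsupport _ ht)
    simp only [Q]
    rw [mul_assoc, norm_mul]
    gcongr
    rw [mul_add]
    refine (norm_add_le _ _).trans (add_le_add ?_ ?_)
    · rw [norm_mul]
      gcongr
      · refine (norm_sub_le _ _).trans ?_
        rw [Circle.norm_coe]; norm_num
      · exact hM σ t h0 h1 htB
    · rcases eq_or_ne t 0 with rfl | ht0
      · simp
      rw [norm_mul, norm_div, norm_one, mul_one_div]
      have h2 : 2 * Real.pi * |t| ≤ ‖(σ : ℂ) + 2 * Real.pi * t * Complex.I‖ := by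
        refine le_trans (le_of_eq ?_) (Complex.abs_im_le_norm _)
        simp [abs_of_pos Real.pi_pos]
      have h3 : ‖1 - (𝐞 (-(t * h)) : ℂ)‖ ≤ 2 * Real.pi * |t| * |h| := by
        rw [Real.fourierChar_apply, norm_sub_rev, mul_comm _ Complex.I]
        refine Real.norm_exp_I_mul_ofReal_sub_one_le.trans (le_of_eq ?_)
        simp [abs_of_pos Real.pi_pos]
        ring
      have h4 : 0 < 2 * Real.pi * |t| := by positivity
      rw [div_le_iff₀ (h4.trans_le h2)]
      nlinarith [abs_nonneg h]
  have hψi : Integrable ψ := hψ.integrable_of_hasCompactSupport hcs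
  -- The bound holds for σ ≤ 1, but the mean Riemann–Lebesgue lemma wants integrability for all σ ≥
  -- 0. Truncating σ at 1 does not affect the limit at 0+.
  have hmin : ∀ σ : ℝ, 0 ≤ σ → 0 ≤ min σ 1 := fun σ hσ => le_min hσ zero_le_one
  have hint : ∀ σ : ℝ, 0 ≤ σ → Integrable (Q (min σ 1)) := fun σ hσ =>
    (hψi.norm.mul_const _).mono' (hmeas _ (hmin σ hσ))
      (by filter_upwards with t using hbound _ t (hmin σ hσ) (min_le_right _ _))
  have hlim : Tendsto (fun σ : ℝ => ∫ t, ‖Q (min σ 1) t - Q (min 0 1) t‖) (𝓝[>] 0) (𝓝 0) := by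
    suffices hs : Tendsto (fun σ : ℝ => ∫ t, ‖Q (min σ 1) t - Q (min 0 1) t‖) (𝓝[>] 0)
        (𝓝 (∫ _ : ℝ, (0 : ℝ))) by rwa [integral_zero] at hs
    refine tendsto_integral_filter_of_dominated_convergence
      (fun t => ‖ψ t‖ * (2 * M + |h|) + ‖ψ t‖ * (2 * M + |h|)) ?_ ?_
      ((hψi.norm.mul_const _).add (hψi.norm.mul_const _)) ?_
    · filter_upwards [self_mem_nhdsWithin] with σ hσ
      exact ((hint σ (le_of_lt hσ)).sub (hint 0 le_rfl)).norm.aestronglyMeasurable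
    · filter_upwards [self_mem_nhdsWithin] with σ hσ
      filter_upwards with t
      rw [norm_norm]
      exact (norm_sub_le _ _).trans (add_le_add
        (hbound _ t (hmin σ (le_of_lt hσ)) (min_le_right _ _))
        (hbound _ t (hmin 0 le_rfl) (min_le_right _ _)))
    · have : ∀ᵐ x : ℝ, x ≠ 0 := by simp [ae_iff]
      filter_upwards [this] with t ht
      suffices hs : Tendsto (fun σ : ℝ => Q (min σ 1) t) (𝓝[>] 0) (𝓝 (Q (min 0 1) t)) by
        simpa using (hs.sub_const (Q (min 0 1) t)).norm
      have hm : Tendsto (fun σ : ℝ => min σ 1) (𝓝[>] 0) (𝓝 (min 0 1)) :=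
        ((continuous_id.min continuous_const).tendsto 0).mono_left nhdsWithin_le_nhds
      have hm' : Tendsto (fun σ : ℝ => ((min σ 1 : ℝ) : ℂ)) (𝓝[>] 0) (𝓝 ((min 0 1 : ℝ) : ℂ)) :=
        (Complex.continuous_ofReal.tendsto _).comp hm
      refine Tendsto.const_mul _ (Tendsto.add ?_ ?_)
      · refine (hc _ ?_).tendsto.comp (tendsto_nhdsWithin_iff.2 ⟨?_, ?_⟩)
        · simp
        · exact (hm'.const_add 1).add_const _
        · filter_upwards [self_mem_nhdsWithin] with σ hσ
          simpa using le_of_lt (show (0 : ℝ) < σ from hσ)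
      · refine Tendsto.div tendsto_const_nhds (hm'.add_const _) fun h0 => ht ?_
        have := congrArg Complex.im h0
        simpa [Real.pi_ne_zero] using this
  refine (tendsto_mul_integral_exp_mul_norm_fourier hint hlim).congr' ?_
  filter_upwards [Ioo_mem_nhdsGT (zero_lt_one' ℝ)] with σ hσ
  congr! 7 with v t
  rw [tsum_vonMangoldtWeight_mul_fourierChar, hH _ (by simpa using hσ.1), min_eq_left hσ.2.le]
  simp only [Q]
  congr 3
  ring

/-- The measures with masses `σ Λ(n) n^(-1-σ)` at `log n` are asymptotically translation
invariant when tested against bounded Lipschitz functions. -/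
theorem tendsto_tsum_vonMangoldtWeight_mul_sub {g : ℝ → ℂ} {C L : ℝ} (hC : ∀ x, ‖g x‖ ≤ C)
    (hL : ∀ x y, ‖g x - g y‖ ≤ L * |x - y|) (h : ℝ) :
    Tendsto (fun σ : ℝ => (σ : ℂ) * ∑' n : ℕ, (vonMangoldtWeight σ n : ℂ) *
      (g (Real.log n) - g (Real.log n + h))) (𝓝[>] 0) (𝓝 0) := by
  have hC0 : 0 ≤ C := (norm_nonneg _).trans (hC 0)
  have hL0 : 0 ≤ L := by simpa using (norm_nonneg _).trans (hL 1 0)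
  have hgc : Continuous g := (LipschitzWith.of_dist_le_mul (K := L.toNNReal) fun x y => by
    simpa [dist_eq_norm, hL0] using hL x y).continuous
  -- The weight at 2σ is the weight at σ times e^(-σ log n). Half of the decay is absorbed into g to
  -- form the integrable f, and the other half keeps the sum convergent after f is replaced by its
  -- smoothing S.
  have main : ∀ (ψ : ℝ → ℂ), Continuous ψ → HasCompactSupport ψ → Integrable (𝓕 ψ) →
      ∫ x, 𝓕 ψ x = 1 → Integrable (fun x => |x| * ‖𝓕 ψ x‖) → ∀ σ : ℝ, 0 < σ →
      ‖∑' n : ℕ, (vonMangoldtWeight (2 * σ) n : ℂ) * (g (Real.log n) - g (Real.log n + h))‖ ≤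
        (∑' n, vonMangoldtWeight σ n) *
          (C * (σ * |h|) + 2 * ((L + C * σ) * ∫ x, |x| * ‖𝓕 ψ x‖)) +
        C * ∫ v, Real.exp (-(σ * |v|)) *
          ‖𝓕 (fun t => (ψ t * (1 - (𝐞 (-(t * h)) : ℂ))) *
            ∑' n, (vonMangoldtWeight σ n : ℂ) * (𝐞 (-(t * Real.log n)) : ℂ)) (-v)‖ := by
    intro ψ hψ hcs hK hK1 hKx σ hσ
    have hψi : Integrable ψ := hψ.integrable_of_hasCompactSupport hcs
    set ψ' : ℝ → ℂ := fun t => ψ t * (1 - (𝐞 (-(t * h)) : ℂ)) with hψ'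
    have hψ'i : Integrable ψ' := by
      have hec : Continuous (fun t : ℝ => (𝐞 (-(t * h)) : ℂ)) :=
        continuous_subtype_val.comp (Real.continuous_fourierChar.comp (by fun_prop))
      refine hψi.mul_bdd (c := 2) (continuous_const.sub hec).aestronglyMeasurable ?_
      filter_upwards with t
      refine (norm_sub_le _ _).trans ?_
      rw [Circle.norm_coe]; norm_num
    have hshift : ∀ x, 𝓕 ψ' x = 𝓕 ψ x - 𝓕 ψ (x + h) := fun x => by
      simp only [Real.fourier_real_eq]
      rw [← integral_sub ((Real.fourierIntegral_convergent_iff x).2 hψi |>.congr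
        (by simp [mul_comm])) ((Real.fourierIntegral_convergent_iff (x + h)).2 hψi |>.congr
        (by simp [mul_comm]))]
      congr 1
      ext t
      have : 𝐞 (-(t * (x + h))) = 𝐞 (-(t * x)) * 𝐞 (-(t * h)) := by
        rw [← AddChar.map_add_eq_mul]
        congr 1
        ring
      simp only [hψ', this, Circle.smul_def, smul_eq_mul, Circle.coe_mul]
      ring
    set f : ℝ → ℂ := fun v => g v * (Real.exp (-(σ * |v|)) : ℂ) with hf
    have hfc : Continuous f := by fun_prop
    have hfn : ∀ v, ‖f v‖ ≤ C * Real.exp (-(σ * |v|)) := fun v => by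
      rw [hf, norm_mul, Complex.norm_real, Real.norm_eq_abs, abs_of_pos (Real.exp_pos _)]
      exact mul_le_mul_of_nonneg_right (hC v) (Real.exp_pos _).le
    have hfi : Integrable f := ((integrable_exp_neg_mul_abs hσ).const_mul C).mono'
      hfc.aestronglyMeasurable (by filter_upwards with v using hfn v)
    have hfC : ∀ v, ‖f v‖ ≤ C := fun v => (hfn v).trans <| mul_le_of_le_one_right hC0 <|
      Real.exp_le_one_iff.2 (by simp; positivity)
    have hfK : ∀ u, Integrable (fun v => f v * 𝓕 ψ (u - v)) := fun u =>
      hfi.mul_bdd (c := ∫ t, ‖ψ t‖)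
        ((Real.continuous_fourier hψi).comp
          (continuous_const.sub continuous_id)).aestronglyMeasurable
        (by filter_upwards with v using Real.norm_fourier_le _ _)
    set S : ℝ → ℂ := fun u => ∫ v, f v * 𝓕 ψ (u - v) with hS
    have hSsub : ∀ u, S u - S (u + h) = ∫ v, f v * 𝓕 ψ' (u - v) := fun u => by
      rw [hS, ← integral_sub (hfK u) (hfK (u + h))]
      congr 1
      ext v
      rw [hshift, ← mul_sub]
      congr 4
      ring_nf
    have hfS : ∀ u, ‖f u - S u‖ ≤ (L + C * σ) * ∫ x, |x| * ‖𝓕 ψ x‖ :=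
      norm_sub_integral_mul_kernel_le (norm_mul_exp_neg_sub_le hC hL hσ.le) hfC hfc hK hK1 hKx
    -- The first term pays for damping at log n + h instead of log n, the second for smoothing f at
    -- the two points.
    set E := C * (σ * |h|) + 2 * ((L + C * σ) * ∫ x, |x| * ‖𝓕 ψ x‖) with hE
    have hterm : ∀ n : ℕ, ‖(vonMangoldtWeight (2 * σ) n : ℂ) *
        (g (Real.log n) - g (Real.log n + h)) - (vonMangoldtWeight σ n : ℂ) *
        (S (Real.log n) - S (Real.log n + h))‖ ≤ vonMangoldtWeight σ n * E := by
      intro n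
      rcases eq_or_ne n 0 with rfl | hn
      · simp [vonMangoldtWeight]
      have hn1 : (1 : ℝ) ≤ n := by exact_mod_cast Nat.one_le_iff_ne_zero.2 hn
      have hlog : 0 ≤ Real.log n := Real.log_nonneg hn1
      have hw : vonMangoldtWeight (2 * σ) n =
          vonMangoldtWeight σ n * Real.exp (-(σ * |Real.log n|)) := by
        rw [vonMangoldtWeight, vonMangoldtWeight, mul_assoc, abs_of_nonneg hlog,
          Real.rpow_def_of_pos (by linarith), Real.rpow_def_of_pos (by linarith), ← Real.exp_add]
        congr 2
        ring
      have hsplit : (vonMangoldtWeight (2 * σ) n : ℂ) *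
          (g (Real.log n) - g (Real.log n + h)) - (vonMangoldtWeight σ n : ℂ) *
          (S (Real.log n) - S (Real.log n + h)) = (vonMangoldtWeight σ n : ℂ) *
          ((f (Real.log n) - S (Real.log n)) - (f (Real.log n + h) - S (Real.log n + h)) -
            g (Real.log n + h) * ((Real.exp (-(σ * |Real.log n|)) -
              Real.exp (-(σ * |Real.log n + h|)) : ℝ) : ℂ)) := by
        rw [hw, hf]
        push_cast
        ring
      rw [hsplit, norm_mul, Complex.norm_real, Real.norm_of_nonneg (vonMangoldtWeight_nonneg _ _)]
      refine mul_le_mul_of_nonneg_left ?_ (vonMangoldtWeight_nonneg _ _)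
      have h1 : ‖g (Real.log n + h) * ((Real.exp (-(σ * |Real.log n|)) -
          Real.exp (-(σ * |Real.log n + h|)) : ℝ) : ℂ)‖ ≤ C * (σ * |h|) := by
        rw [norm_mul, Complex.norm_real]
        refine mul_le_mul (hC _) ?_ (norm_nonneg _) hC0
        simpa using abs_exp_neg_mul_abs_sub_le hσ.le (Real.log n) (Real.log n + h)
      refine (norm_sub_le _ _).trans ?_
      have h2 := norm_sub_le (f (Real.log n) - S (Real.log n))
        (f (Real.log n + h) - S (Real.log n + h))
      have h3 := hfS (Real.log n)
      have h4 := hfS (Real.log n + h)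
      linarith
    have hws := summable_vonMangoldtWeight hσ
    have hsumD := Summable.of_norm_bounded (hws.mul_right E) hterm
    have hsum1 : Summable fun n : ℕ => (vonMangoldtWeight (2 * σ) n : ℂ) *
        (g (Real.log n) - g (Real.log n + h)) := by
      refine Summable.of_norm_bounded
        ((summable_vonMangoldtWeight (by linarith : 0 < 2 * σ)).mul_right (C + C)) fun n => ?_
      rw [norm_mul, Complex.norm_real, Real.norm_of_nonneg (vonMangoldtWeight_nonneg _ _)]
      exact mul_le_mul_of_nonneg_left ((norm_sub_le _ _).trans (add_le_add (hC _) (hC _)))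
        (vonMangoldtWeight_nonneg _ _)
    have hsum2 := hsum1.sub hsumD
    simp only [sub_sub_cancel] at hsum2
    have heq : ∑' n : ℕ, (vonMangoldtWeight (2 * σ) n : ℂ) *
        (g (Real.log n) - g (Real.log n + h)) =
        (∑' n : ℕ, ((vonMangoldtWeight (2 * σ) n : ℂ) *
          (g (Real.log n) - g (Real.log n + h)) - (vonMangoldtWeight σ n : ℂ) *
          (S (Real.log n) - S (Real.log n + h)))) +
        ∑' n : ℕ, (vonMangoldtWeight σ n : ℂ) * (S (Real.log n) - S (Real.log n + h)) := by
      rw [← hsumD.tsum_add hsum2]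
      simp
    rw [heq]
    refine (norm_add_le _ _).trans (add_le_add ?_ ?_)
    · rw [← tsum_mul_right]
      exact tsum_of_norm_bounded (hws.mul_right E).hasSum hterm
    · simp only [hSsub]
      rw [tsum_mul_integral_mul_fourier (by simpa using hws.abs) (fun n => Real.log n) hψ'i hfi,
        ← integral_const_mul]
      have hQi : Integrable (fun t => ψ' t * ∑' n : ℕ, (vonMangoldtWeight σ n : ℂ) *
          (𝐞 (-(t * Real.log n)) : ℂ)) := by
        refine hψ'i.mul_bdd (c := ∑' n, vonMangoldtWeight σ n) ?_ ?_
        · refine (continuous_tsum (u := vonMangoldtWeight σ) (fun n => ?_) hws fun n t => ?_).aestronglyMeasurable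
          · exact continuous_const.mul
              (continuous_subtype_val.comp (Real.continuous_fourierChar.comp (by fun_prop)))
          · rw [norm_mul, Circle.norm_coe, mul_one, Complex.norm_real,
              Real.norm_of_nonneg (vonMangoldtWeight_nonneg σ n)]
        · filter_upwards with t
          refine tsum_of_norm_bounded hws.hasSum fun n => ?_
          rw [norm_mul, Circle.norm_coe, mul_one, Complex.norm_real,
              Real.norm_of_nonneg (vonMangoldtWeight_nonneg σ n)]
      refine norm_integral_le_of_norm_le (Integrable.const_mul ?_ C) ?_
      · refine (integrable_exp_neg_mul_abs hσ).mul_bdd (c := ∫ t, ‖ψ' t * ∑' n : ℕ,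
          (vonMangoldtWeight σ n : ℂ) * (𝐞 (-(t * Real.log n)) : ℂ)‖)
          (((Real.continuous_fourier hQi).comp continuous_neg).norm).aestronglyMeasurable ?_
        filter_upwards with v
        rw [norm_norm]
        exact Real.norm_fourier_le _ (-v)
      · filter_upwards with v
        rw [norm_mul, ← mul_assoc]
        exact mul_le_mul_of_nonneg_right (hfn v) (norm_nonneg _)
  have hhalf : Tendsto (fun σ : ℝ => σ / 2) (𝓝[>] 0) (𝓝[>] 0) := by
    refine tendsto_nhdsWithin_iff.2 ⟨?_, ?_⟩
    · simpa using ((continuous_id.div_const (2 : ℝ)).tendsto 0).mono_left nhdsWithin_le_nhds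
    · filter_upwards [self_mem_nhdsWithin] with σ hσ
      exact half_pos (show (0 : ℝ) < σ from hσ)
  suffices hs : Tendsto (fun σ : ℝ => (σ : ℂ) * ∑' n : ℕ, (vonMangoldtWeight (2 * σ) n : ℂ) *
      (g (Real.log n) - g (Real.log n + h))) (𝓝[>] 0) (𝓝 0) by
    have := (hs.comp hhalf).const_mul 2
    rw [mul_zero] at this
    refine this.congr fun σ => ?_
    simp only [Function.comp, mul_div_cancel₀ σ (two_ne_zero' ℝ)]
    push_cast
    ring
  rw [Metric.tendsto_nhds]
  intro ε hε
  -- The limiting error is 2L times the first moment, hence at most ε/2. The +1 covers L = 0.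
  obtain ⟨ψ, hψ, hcs, hK, hK1, hKx, hKε⟩ :=
    exists_bandlimited_kernel (ε := ε / (4 * (L + 1))) (by positivity)
  have h1 := (tendsto_translation_defect_fourier hψ hcs h).const_mul C
  have hid : Tendsto (fun σ : ℝ => σ) (𝓝[>] 0) (𝓝 0) := nhdsWithin_le_nhds
  have h2 : Tendsto (fun σ : ℝ => C * (σ * |h|) + 2 * ((L + C * σ) * ∫ x, |x| * ‖𝓕 ψ x‖)) (𝓝[>] 0)
      (𝓝 (C * (0 * |h|) + 2 * ((L + C * 0) * ∫ x, |x| * ‖𝓕 ψ x‖))) :=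
    ((hid.mul_const _).const_mul _).add ((((hid.const_mul C).const_add L).mul_const _).const_mul 2)
  have h3 := (tendsto_mul_tsum_vonMangoldtWeight.mul h2).add h1
  have hlt : 1 * (C * (0 * |h|) + 2 * ((L + C * 0) * ∫ x, |x| * ‖𝓕 ψ x‖)) + C * 0 < ε := by
    have h4 : L * ∫ x, |x| * ‖𝓕 ψ x‖ ≤ L * (ε / (4 * (L + 1))) := by gcongr
    have h5 : L * (ε / (4 * (L + 1))) ≤ ε / 4 := by
      rw [mul_div_assoc', div_le_div_iff₀ (by positivity) (by norm_num)]
      nlinarith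
    linarith
  filter_upwards [h3.eventually_lt_const hlt, self_mem_nhdsWithin] with σ hσ hσ0
  have hσ0 : (0 : ℝ) < σ := hσ0
  rw [dist_zero_right, norm_mul, Complex.norm_real, Real.norm_of_nonneg hσ0.le]
  refine lt_of_le_of_lt ?_ hσ
  refine (mul_le_mul_of_nonneg_left (main ψ hψ hcs hK hK1 hKx σ hσ0) hσ0.le).trans (le_of_eq ?_)
  ring

/-! ### Weights on the primes -/

/-- The restriction of `vonMangoldtWeight` to primes. -/
noncomputable def primeWeight (σ : ℝ) (n : ℕ) : ℝ := if n.Prime then vonMangoldtWeight σ n else 0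

theorem primeWeight_nonneg (σ : ℝ) (n : ℕ) : 0 ≤ primeWeight σ n := by
  unfold primeWeight
  split_ifs
  exacts [vonMangoldtWeight_nonneg σ n, le_rfl]

theorem primeWeight_le (σ : ℝ) (n : ℕ) : primeWeight σ n ≤ vonMangoldtWeight σ n := by
  unfold primeWeight
  split_ifs
  exacts [le_rfl, vonMangoldtWeight_nonneg σ n]

theorem summable_primeWeight {σ : ℝ} (hσ : 0 < σ) : Summable (primeWeight σ) :=
  Summable.of_nonneg_of_le (primeWeight_nonneg σ) (primeWeight_le σ) (summable_vonMangoldtWeight hσ)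

theorem summable_vonMangoldt_nonprime_div :
    Summable fun n : ℕ => (if n.Prime then 0 else Λ n) / n := by
  refine (vonMangoldt.summable_residueClass_non_primes_div (1 : ZMod 1)).congr fun n => ?_
  simp [vonMangoldt.residueClass, Subsingleton.elim (n : ZMod 1) 1]

theorem vonMangoldtWeight_sub_primeWeight_le {σ : ℝ} (hσ : 0 ≤ σ) (n : ℕ) :
    vonMangoldtWeight σ n - primeWeight σ n ≤ (if n.Prime then 0 else Λ n) / n := by
  rcases eq_or_ne n 0 with rfl | hn
  · simp [vonMangoldtWeight, primeWeight]
  have hn1 : (1 : ℝ) ≤ n := by exact_mod_cast Nat.one_le_iff_ne_zero.2 hn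
  unfold primeWeight
  split_ifs
  · simp
  · rw [sub_zero, vonMangoldtWeight, div_eq_mul_inv, ← Real.rpow_neg_one]
    exact mul_le_mul_of_nonneg_left (Real.rpow_le_rpow_of_exponent_le hn1 (by linarith))
      vonMangoldt_nonneg

/-- Replacing prime powers by primes changes the weighted means of a bounded function by `o(1)`. -/
theorem tendsto_mul_tsum_sub_primeWeight {f : ℕ → ℂ} {C : ℝ} (hC : ∀ n, ‖f n‖ ≤ C) :
    Tendsto (fun σ : ℝ => (σ : ℂ) * ∑' n, (vonMangoldtWeight σ n : ℂ) * f n -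
      (σ : ℂ) * ∑' n, (primeWeight σ n : ℂ) * f n) (𝓝[>] 0) (𝓝 0) := by
  set B := ∑' n : ℕ, ((if n.Prime then 0 else Λ n) / n) * C with hB
  have hid : Tendsto (fun σ : ℝ => σ * B) (𝓝[>] 0) (𝓝 0) := by
    have : Tendsto (fun σ : ℝ => σ) (𝓝[>] 0) (𝓝 0) := nhdsWithin_le_nhds
    simpa using this.mul_const B
  have hC0 : 0 ≤ C := (norm_nonneg _).trans (hC 0)
  refine squeeze_zero_norm' ?_ hid
  filter_upwards [self_mem_nhdsWithin] with σ hσ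
  have hσ : (0 : ℝ) < σ := hσ
  have hs : ∀ w : ℕ → ℝ, (∀ n, 0 ≤ w n) → Summable w → Summable fun n => (w n : ℂ) * f n :=
    fun w h0 hw => Summable.of_norm_bounded (hw.mul_right C) fun n => by
      rw [norm_mul, Complex.norm_real, Real.norm_of_nonneg (h0 n)]
      exact mul_le_mul_of_nonneg_left (hC n) (h0 n)
  rw [← mul_sub, ← (hs _ (vonMangoldtWeight_nonneg σ) (summable_vonMangoldtWeight hσ)).tsum_sub
    (hs _ (primeWeight_nonneg σ) (summable_primeWeight hσ)), norm_mul, Complex.norm_real,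
    Real.norm_of_nonneg hσ.le]
  refine mul_le_mul_of_nonneg_left (tsum_of_norm_bounded
    (summable_vonMangoldt_nonprime_div.mul_right C).hasSum fun n => ?_) hσ.le
  rw [← sub_mul, norm_mul, ← Complex.ofReal_sub, Complex.norm_real,
    Real.norm_of_nonneg (sub_nonneg.2 (primeWeight_le σ n))]
  exact mul_le_mul (vonMangoldtWeight_sub_primeWeight_le hσ.le n) (hC n) (norm_nonneg _)
    ((sub_nonneg.2 (primeWeight_le σ n)).trans (vonMangoldtWeight_sub_primeWeight_le hσ.le n))

theorem tendsto_mul_tsum_primeWeight :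
    Tendsto (fun σ => σ * ∑' n, primeWeight σ n) (𝓝[>] 0) (𝓝 1) := by
  have h := tendsto_mul_tsum_sub_primeWeight (f := fun _ => 1) (C := 1) (by simp)
  have h2 : Tendsto (fun σ : ℝ => σ * ∑' n, vonMangoldtWeight σ n - σ * ∑' n, primeWeight σ n)
      (𝓝[>] 0) (𝓝 0) := by
    have h3 := (Complex.continuous_re.tendsto _).comp h
    simp only [mul_one, Complex.zero_re] at h3
    refine h3.congr fun σ => ?_
    simp only [Function.comp, ← Complex.ofReal_tsum, ← Complex.ofReal_mul, ← Complex.ofReal_sub,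
      Complex.ofReal_re]
  simpa using tendsto_mul_tsum_vonMangoldtWeight.sub h2

/-- Use log n ≤ n^(σ/2)/(σ/2) on one logarithm and n^(-1-τ) ≤ n^(-1). The ratio τ/σ makes
well-separated scales nearly orthogonal. -/
theorem primeWeight_mul_primeWeight_le {σ τ : ℝ} (hσ : 0 < σ) (hτ : 0 < τ) (n : ℕ) :
    n * (σ * primeWeight σ n * (τ * primeWeight τ n)) ≤
      4 * (τ / σ) * (σ / 2 * primeWeight (σ / 2) n) := by
  unfold primeWeight
  split_ifs with hn
  swap
  · simp
  have hn1 : (1 : ℝ) ≤ n := by exact_mod_cast hn.one_le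
  have hn0 : (0 : ℝ) < n := by linarith
  simp only [vonMangoldtWeight, vonMangoldt_apply_prime hn]
  have hlog := Real.log_nonneg hn1
  have h1 : Real.log n ≤ (n : ℝ) ^ (σ / 2) / (σ / 2) := Real.log_le_rpow_div hn0.le (by linarith)
  have h2 : (n : ℝ) ^ (-(1 + τ)) ≤ (n : ℝ) ^ (-1 : ℝ) :=
    Real.rpow_le_rpow_of_exponent_le hn1 (by linarith)
  have h3 : (n : ℝ) ^ (-(1 + σ / 2)) = (n : ℝ) ^ (σ / 2) * (n : ℝ) ^ (-(1 + σ)) := by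
    rw [← Real.rpow_add hn0]; congr 1; ring
  rw [h3]
  rw [Real.rpow_neg_one] at h2
  calc (n : ℝ) * (σ * (Real.log n * (n : ℝ) ^ (-(1 + σ))) *
        (τ * (Real.log n * (n : ℝ) ^ (-(1 + τ)))))
      = σ * τ * Real.log n * (n : ℝ) ^ (-(1 + σ)) * (n * (Real.log n * (n : ℝ) ^ (-(1 + τ)))) := by
        ring
    _ ≤ σ * τ * Real.log n * (n : ℝ) ^ (-(1 + σ)) *
        (n * ((n : ℝ) ^ (σ / 2) / (σ / 2) * (n : ℝ)⁻¹)) := by gcongr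
    _ = _ := by field_simp; ring

/-- Enlarging the square by one adds a row, a column and a diagonal entry, each of total at most A.
-/
theorem sum_sum_le_of_geometric_decay {M : ℕ → ℕ → ℝ} {A : ℝ} (hA : 0 ≤ A)
    (h : ∀ i k, M i (i + k) ≤ A * (1 / 2) ^ k) (hsymm : ∀ i j, M i j = M j i) (J : ℕ) :
    ∑ i ∈ Finset.range J, ∑ j ∈ Finset.range J, M i j ≤ 3 * A * J := by
  induction J with
  | zero => simp
  | succ J ih =>
    have hrow : ∑ i ∈ Finset.range J, M i J ≤ A := by
      calc ∑ i ∈ Finset.range J, M i J ≤ ∑ i ∈ Finset.range J, A * (1 / 2) ^ (J - 1 - i + 1) := by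
            refine Finset.sum_le_sum fun i hi => ?_
            have hi' := Finset.mem_range.1 hi
            have h1 := h i (J - 1 - i + 1)
            rwa [show i + (J - 1 - i + 1) = J by omega] at h1
        _ = ∑ i ∈ Finset.range J, A * (1 / 2) ^ (i + 1) :=
            Finset.sum_range_reflect (fun i => A * (1 / 2 : ℝ) ^ (i + 1)) J
        _ = A * (1 - (1 / 2) ^ J) := by
            simp only [pow_succ, ← mul_assoc]
            rw [← Finset.sum_mul, ← Finset.mul_sum, geom_sum_eq (by norm_num)]
            ring
        _ ≤ A := mul_le_of_le_one_right hA (by simp)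
    have hdiag : M J J ≤ A := by simpa using h J 0
    rw [Finset.sum_range_succ]
    simp only [Finset.sum_range_succ _ J, Finset.sum_add_distrib]
    have : ∑ j ∈ Finset.range J, M J j = ∑ i ∈ Finset.range J, M i J :=
      Finset.sum_congr rfl fun j _ => hsymm J j
    push_cast
    linarith

/-- Nonnegative weights on the primes of total mass at least `1/2`, for which the
Turán–Kubilius variance and the translation defect against `g` are small. -/
theorem exists_prime_weights {g : ℝ → ℂ} {C L : ℝ} (hC : ∀ x, ‖g x‖ ≤ C)
    (hL : ∀ x y, ‖g x - g y‖ ≤ L * |x - y|) (h : ℝ) {ε : ℝ} (hε : 0 < ε) :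
    ∃ c : ℕ → ℝ, (∀ n, ¬ n.Prime → c n = 0) ∧ (∀ n, 0 ≤ c n) ∧
      Summable (fun n => c n / n) ∧ 1 / 2 ≤ ∑' n, c n / n ∧
      Summable (fun n => c n ^ 2 / n) ∧ ∑' n, c n ^ 2 / n ≤ ε ∧
      ‖∑' n : ℕ, ((c n / n : ℝ) : ℂ) * (g (Real.log n) - g (Real.log n + h))‖ ≤ ε := by
  set D : ℕ → ℂ := fun n => g (Real.log n) - g (Real.log n + h) with hD
  have hDC : ∀ n, ‖D n‖ ≤ C + C := fun n => (norm_sub_le _ _).trans (add_le_add (hC _) (hC _))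
  have hdef : Tendsto (fun σ : ℝ => (σ : ℂ) * ∑' n, (primeWeight σ n : ℂ) * D n)
      (𝓝[>] 0) (𝓝 0) := by
    have h1 := (tendsto_tsum_vonMangoldtWeight_mul_sub hC hL h).sub
      (tendsto_mul_tsum_sub_primeWeight hDC)
    rw [sub_zero] at h1
    exact h1.congr fun σ => sub_sub_cancel _ _
  have hev := (((tendsto_mul_tsum_primeWeight.eventually_const_lt (by norm_num : (1 / 2 : ℝ) < 1)).and
    (tendsto_mul_tsum_primeWeight.eventually_lt_const (by norm_num : (1 : ℝ) < 2))).and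
    (hdef.norm.eventually_lt_const (by simpa using hε)))
  obtain ⟨δ, hδ, hδP⟩ := mem_nhdsGT_iff_exists_Ioo_subset.1 hev
  have hδ : (0 : ℝ) < δ := hδ
  have hP : ∀ σ : ℝ, 0 < σ → σ < δ → ((1 / 2 < σ * ∑' n, primeWeight σ n ∧
      σ * ∑' n, primeWeight σ n < 2) ∧ ‖(σ : ℂ) * ∑' n, (primeWeight σ n : ℂ) * D n‖ < ε) :=
    fun σ h0 h1 => hδP ⟨h0, h1⟩
  clear hδP hev
  -- A single scale has mass near 1 but second moment only O(1). Averaging J dyadic scales keeps the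
  -- mass and the defect bound, and near-orthogonality divides the second moment by about J.
  set s : ℕ → ℝ := fun j => δ / 2 * (1 / 2) ^ j with hs
  have hs0 : ∀ j, 0 < s j := fun j => by positivity
  have hsδ : ∀ j, s j < δ := fun j => by
    have : (1 / 2 : ℝ) ^ j ≤ 1 := pow_le_one₀ (by norm_num) (by norm_num)
    simp only [hs]
    nlinarith
  set x : ℕ → ℕ → ℝ := fun j n => s j * primeWeight (s j) n with hx
  have hx0 : ∀ j n, 0 ≤ x j n := fun j n => mul_nonneg (hs0 j).le (primeWeight_nonneg _ _)
  have hxs : ∀ j, Summable (x j) := fun j => (summable_primeWeight (hs0 j)).mul_left _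
  have hxx : ∀ i j n, n * (x i n * x j n) ≤
      4 * (s j / s i) * (s i / 2 * primeWeight (s i / 2) n) := fun i j n =>
    primeWeight_mul_primeWeight_le (hs0 i) (hs0 j) n
  have hxxs : ∀ i j, Summable fun n : ℕ => n * (x i n * x j n) := fun i j =>
    Summable.of_nonneg_of_le
      (fun n => mul_nonneg n.cast_nonneg (mul_nonneg (hx0 i n) (hx0 j n))) (hxx i j)
      (((summable_primeWeight (half_pos (hs0 i))).mul_left _).mul_left _)
  -- The scale s i / 2 is still below δ, so its mass is below 2, giving 4 · 2.
  have hM : ∀ i k, ∑' n : ℕ, n * (x i n * x (i + k) n) ≤ 8 * (1 / 2) ^ k := fun i k => by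
    have h1 := (hxxs i (i + k)).tsum_le_tsum (hxx i (i + k))
      (((summable_primeWeight (half_pos (hs0 i))).mul_left _).mul_left _)
    rw [tsum_mul_left, tsum_mul_left] at h1
    have h2 : s (i + k) / s i = (1 / 2) ^ k := by
      simp only [hs, pow_add]
      field_simp
    have h3 := (hP (s i / 2) (half_pos (hs0 i)) (by linarith [hsδ i, hs0 i])).1.2
    rw [h2] at h1
    have h4 : (0 : ℝ) < (1 / 2) ^ k := by positivity
    nlinarith
  -- The second moment will be at most 3 · 8 · J / J² = 24/J.
  obtain ⟨J, hJ⟩ := exists_nat_gt (24 / ε)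
  have hJ0 : (0 : ℝ) < J := lt_trans (by positivity) hJ
  set y : ℕ → ℝ := fun n => (J : ℝ)⁻¹ * ∑ j ∈ Finset.range J, x j n with hy
  have hy0 : ∀ n, 0 ≤ y n := fun n =>
    mul_nonneg (by positivity) (Finset.sum_nonneg fun j _ => hx0 j n)
  have hyz : ∀ n, ¬ n.Prime → y n = 0 := fun n hn => by simp [hy, hx, primeWeight, hn]
  have hdiv : ∀ n : ℕ, n * y n / n = y n := fun n => by
    rcases eq_or_ne n 0 with rfl | hn
    · simp [hyz 0 Nat.not_prime_zero]
    · field_simp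
  have hsq : ∀ n : ℕ, (n * y n) ^ 2 / n = (J : ℝ)⁻¹ ^ 2 *
      ∑ i ∈ Finset.range J, ∑ j ∈ Finset.range J, n * (x i n * x j n) := fun n => by
    rw [pow_two, mul_div_assoc, hdiv, hy]
    simp only [← Finset.mul_sum, ← Finset.sum_mul]
    ring
  refine ⟨fun n => n * y n, fun n hn => by simp [hyz n hn],
    fun n => mul_nonneg n.cast_nonneg (hy0 n), ?_, ?_, ?_, ?_, ?_⟩
  · simp only [hdiv]
    exact (summable_sum fun j _ => hxs j).mul_left _
  · simp only [hdiv]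
    simp only [hy]
    rw [tsum_mul_left, Summable.tsum_finsetSum fun j _ => hxs j]
    have : ∑ j ∈ Finset.range J, (1 / 2 : ℝ) ≤ ∑ j ∈ Finset.range J, ∑' n, x j n :=
      Finset.sum_le_sum fun j _ => by
        simp only [hx, tsum_mul_left]
        exact (hP _ (hs0 j) (hsδ j)).1.1.le
    rw [Finset.sum_const, Finset.card_range, nsmul_eq_mul] at this
    rw [inv_mul_eq_div, le_div_iff₀ hJ0]
    linarith
  · simp only [hsq]
    exact (summable_sum fun i _ => summable_sum fun j _ => hxxs i j).mul_left _
  · simp only [hsq]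
    rw [tsum_mul_left, Summable.tsum_finsetSum fun i _ => summable_sum fun j _ => hxxs i j]
    simp only [Summable.tsum_finsetSum fun j (_ : j ∈ Finset.range J) => hxxs _ j]
    have := sum_sum_le_of_geometric_decay (M := fun i j => ∑' n : ℕ, n * (x i n * x j n))
      (by norm_num : (0 : ℝ) ≤ 8) hM (fun i j => by simp only [mul_comm (x i _)]) J
    rw [inv_pow, inv_mul_eq_div, div_le_iff₀ (by positivity)]
    rw [div_lt_iff₀ hε] at hJ
    nlinarith
  · simp only [hdiv]
    simp only [hy]
    have hsD : ∀ j, Summable fun n => (x j n : ℂ) * D n := fun j =>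
      Summable.of_norm_bounded ((hxs j).mul_right (C + C)) fun n => by
        rw [norm_mul, Complex.norm_real, Real.norm_of_nonneg (hx0 j n)]
        exact mul_le_mul_of_nonneg_left (hDC n) (hx0 j n)
    have heq : ∀ n, (((J : ℝ)⁻¹ * ∑ j ∈ Finset.range J, x j n : ℝ) : ℂ) * D n =
        ((J : ℝ)⁻¹ : ℂ) * ∑ j ∈ Finset.range J, (x j n : ℂ) * D n := fun n => by
      push_cast
      rw [mul_assoc, Finset.sum_mul]
    change ‖∑' n : ℕ, (((J : ℝ)⁻¹ * ∑ j ∈ Finset.range J, x j n : ℝ) : ℂ) * D n‖ ≤ ε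
    simp only [heq]
    rw [tsum_mul_left, Summable.tsum_finsetSum fun j _ => hsD j, norm_mul]
    have : ‖∑ j ∈ Finset.range J, ∑' n, (x j n : ℂ) * D n‖ ≤ ∑ j ∈ Finset.range J, ε := by
      refine norm_sum_le_of_le _ fun j _ => ?_
      have := (hP _ (hs0 j) (hsδ j)).2.le
      rw [← tsum_mul_left] at this
      simpa [hx, mul_assoc] using this
    rw [Finset.sum_const, Finset.card_range, nsmul_eq_mul] at this
    rw [norm_inv, Complex.norm_real, Real.norm_of_nonneg hJ0.le, inv_mul_eq_div, div_le_iff₀ hJ0]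
    linarith

/-! ### Means of a ∘ Ω on a logarithmic scale -/

/-- The mean of `a (Ω n)` over `1 ≤ n ≤ exp u`. -/
noncomputable def expMean (a : ℕ → ℂ) (u : ℝ) : ℂ :=
  (Real.exp (-u) : ℂ) * ∑ n ∈ Finset.Icc 1 ⌊Real.exp u⌋₊, a (cardFactors n)

theorem exp_neg_mul_floor_le_one (u : ℝ) : Real.exp (-u) * ⌊Real.exp u⌋₊ ≤ 1 := by
  calc _ ≤ Real.exp (-u) * Real.exp u := by
        gcongr
        exact Nat.floor_le (Real.exp_pos u).le
    _ = 1 := by rw [← Real.exp_add]; simp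

theorem norm_expMean_le {a : ℕ → ℂ} {C : ℝ} (hC : ∀ n, ‖a n‖ ≤ C) (u : ℝ) :
    ‖expMean a u‖ ≤ C := by
  have hC0 : 0 ≤ C := (norm_nonneg _).trans (hC 0)
  rw [expMean, norm_mul, Complex.norm_real, Real.norm_of_nonneg (Real.exp_pos _).le]
  calc _ ≤ Real.exp (-u) * (⌊Real.exp u⌋₊ * C) := by
        gcongr
        refine (norm_sum_le_of_le _ fun n _ => hC _).trans (le_of_eq ?_)
        simp
    _ = Real.exp (-u) * ⌊Real.exp u⌋₊ * C := by ring
    _ ≤ 1 * C := by gcongr; exact exp_neg_mul_floor_le_one u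
    _ = C := one_mul C

/-- The change of normalisation and the added terms each cost v - u; rounding e^u and e^v to
integers costs e^(-v). -/
theorem norm_expMean_sub_le {a : ℕ → ℂ} {C : ℝ} (hC : ∀ n, ‖a n‖ ≤ C) {u v : ℝ} (huv : u ≤ v) :
    ‖expMean a v - expMean a u‖ ≤ C * (2 * (v - u) + Real.exp (-v)) := by
  have hC0 : 0 ≤ C := (norm_nonneg _).trans (hC 0)
  have hle : ⌊Real.exp u⌋₊ ≤ ⌊Real.exp v⌋₊ := Nat.floor_mono (Real.exp_le_exp.2 huv)
  have hsplit : ∑ n ∈ Finset.Icc 1 ⌊Real.exp v⌋₊, a (cardFactors n) =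
      ∑ n ∈ Finset.Icc 1 ⌊Real.exp u⌋₊, a (cardFactors n) +
        ∑ n ∈ Finset.Ioc ⌊Real.exp u⌋₊ ⌊Real.exp v⌋₊, a (cardFactors n) := by
    have h (N : ℕ) : Finset.Icc 1 N = Finset.Ioc 0 N := rfl
    rw [h, h, Finset.sum_Ioc_consecutive _ (Nat.zero_le _) hle]
  have heq : expMean a v - expMean a u =
      ((Real.exp (-v) - Real.exp (-u) : ℝ) : ℂ) *
        ∑ n ∈ Finset.Icc 1 ⌊Real.exp u⌋₊, a (cardFactors n) +
      (Real.exp (-v) : ℂ) * ∑ n ∈ Finset.Ioc ⌊Real.exp u⌋₊ ⌊Real.exp v⌋₊, a (cardFactors n) := by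
    rw [expMean, expMean, hsplit]
    push_cast
    ring
  have hfu := Nat.floor_le (Real.exp_pos u).le
  have hfv := Nat.floor_le (Real.exp_pos v).le
  have hfu' := Nat.lt_floor_add_one (Real.exp u)
  have hexp : Real.exp (-v) ≤ Real.exp (-u) := Real.exp_le_exp.2 (by linarith)
  have h1 : 1 - Real.exp (-v) * Real.exp u ≤ v - u := by
    rw [← Real.exp_add]
    linarith [Real.add_one_le_exp (-v + u)]
  have h2 : Real.exp (-u) * Real.exp u = 1 := by rw [← Real.exp_add]; simp
  have h3 : Real.exp (-v) * Real.exp v = 1 := by rw [← Real.exp_add]; simp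
  have h4 : ‖∑ n ∈ Finset.Icc 1 ⌊Real.exp u⌋₊, a (cardFactors n)‖ ≤ Real.exp u * C := by
    refine (norm_sum_le_of_le _ fun n _ => hC _).trans ?_
    simp only [Finset.sum_const, Nat.card_Icc, Nat.add_sub_cancel, nsmul_eq_mul]
    gcongr
  have h5 : ‖∑ n ∈ Finset.Ioc ⌊Real.exp u⌋₊ ⌊Real.exp v⌋₊, a (cardFactors n)‖ ≤
      (Real.exp v - Real.exp u + 1) * C := by
    refine (norm_sum_le_of_le _ fun n _ => hC _).trans ?_
    simp only [Finset.sum_const, Nat.card_Ioc, nsmul_eq_mul]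
    rw [Nat.cast_sub hle]
    gcongr
    linarith
  rw [heq]
  refine (norm_add_le _ _).trans ?_
  rw [norm_mul, norm_mul, Complex.norm_real, Complex.norm_real,
    Real.norm_of_nonneg (Real.exp_pos _).le, Real.norm_of_nonpos (by linarith)]
  calc _ ≤ -(Real.exp (-v) - Real.exp (-u)) * (Real.exp u * C) +
        Real.exp (-v) * ((Real.exp v - Real.exp u + 1) * C) := by
        gcongr
        linarith
    _ = C * ((Real.exp (-u) * Real.exp u - Real.exp (-v) * Real.exp u) +
        (Real.exp (-v) * Real.exp v - Real.exp (-v) * Real.exp u) + Real.exp (-v)) := by ring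
    _ ≤ _ := by
        rw [h2, h3]
        gcongr
        linarith

/-- Multiples of a prime `p` carry the mean of the shifted function at scale `1 / p`. -/
theorem expMean_shift_sub_log (a : ℕ → ℂ) {p : ℕ} (hp : p.Prime) (u : ℝ) :
    ((p : ℝ)⁻¹ : ℂ) * expMean (fun k => a (k + 1)) (u - Real.log p) =
      (Real.exp (-u) : ℂ) * ∑ n ∈ Finset.Icc 1 ⌊Real.exp u⌋₊,
        if p ∣ n then a (cardFactors n) else 0 := by
  have hp0 : (0 : ℝ) < p := by exact_mod_cast hp.pos
  have hpC : (p : ℂ) ≠ 0 := by exact_mod_cast hp.ne_zero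
  have h1 : Real.exp (-(u - Real.log p)) = p * Real.exp (-u) := by
    rw [neg_sub, sub_eq_add_neg, Real.exp_add, Real.exp_log hp0]
  have h2 : ⌊Real.exp (u - Real.log p)⌋₊ = ⌊Real.exp u⌋₊ / p := by
    rw [Real.exp_sub, Real.exp_log hp0, Nat.floor_div_natCast]
  have h3 : ∑ m ∈ Finset.Icc 1 (⌊Real.exp u⌋₊ / p), a (cardFactors m + 1) =
      ∑ n ∈ (Finset.Icc 1 ⌊Real.exp u⌋₊).filter (p ∣ ·), a (cardFactors n) := by
    refine Finset.sum_bij (fun m _ => p * m) ?_ ?_ ?_ ?_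
    · intro m hm
      rw [Finset.mem_Icc] at hm
      refine Finset.mem_filter.2 ⟨Finset.mem_Icc.2 ⟨Nat.mul_pos hp.pos hm.1, ?_⟩, dvd_mul_right _ _⟩
      exact (Nat.mul_le_mul_left p hm.2).trans (Nat.mul_div_le _ _)
    · intro m _ m' _ h
      exact Nat.eq_of_mul_eq_mul_left hp.pos h
    · intro n hn
      obtain ⟨hn, m, rfl⟩ := Finset.mem_filter.1 hn
      rw [Finset.mem_Icc] at hn
      exact ⟨m, Finset.mem_Icc.2 ⟨Nat.pos_of_mul_pos_left hn.1,
        (Nat.le_div_iff_mul_le hp.pos).2 (by linarith [mul_comm m p])⟩, rfl⟩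
    · intro m hm
      rw [Finset.mem_Icc] at hm
      rw [cardFactors_mul hp.ne_zero (by omega), cardFactors_apply_prime hp, add_comm]
  rw [expMean, h1, h2, h3, Finset.sum_filter]
  push_cast
  field_simp

/-! ### The Turán–Kubilius inequality -/

theorem tendsto_exp_neg_mul_card_multiples {m : ℕ} (hm : m ≠ 0) :
    Tendsto (fun u : ℝ => Real.exp (-u) * ∑ n ∈ Finset.Icc 1 ⌊Real.exp u⌋₊,
      if m ∣ n then (1 : ℝ) else 0) atTop (𝓝 (m : ℝ)⁻¹) := by
  have hm0 : (0 : ℝ) < m := by exact_mod_cast Nat.pos_of_ne_zero hm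
  have h1 : ∀ u : ℝ, ∑ n ∈ Finset.Icc 1 ⌊Real.exp u⌋₊, (if m ∣ n then (1 : ℝ) else 0) =
      ⌊Real.exp u / m⌋₊ := fun u => by
    rw [Finset.sum_boole, Nat.floor_div_natCast, ← Nat.Ioc_filter_dvd_card_eq_div]
    rfl
  simp only [h1]
  have h2 : Tendsto (fun u : ℝ => Real.exp u / m) atTop atTop :=
    Real.tendsto_exp_atTop.atTop_div_const hm0
  have h3 := ((tendsto_nat_floor_div_atTop (R := ℝ)).comp h2).mul_const (m : ℝ)⁻¹
  rw [one_mul] at h3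
  refine h3.congr fun u => ?_
  simp only [Function.comp]
  rw [Real.exp_neg]
  field_simp

/-- Asymptotic variance of a weighted count of prime divisors (Turán–Kubilius). -/
theorem tendsto_turan_kubilius_variance (c : ℕ → ℝ) {P : Finset ℕ} (hP : ∀ p ∈ P, p.Prime) :
    Tendsto (fun u : ℝ => Real.exp (-u) * ∑ n ∈ Finset.Icc 1 ⌊Real.exp u⌋₊,
      (∑ p ∈ P, c p * ((p : ℝ)⁻¹ - if p ∣ n then 1 else 0)) ^ 2) atTop
      (𝓝 (∑ p ∈ P, c p ^ 2 * ((p : ℝ)⁻¹ - (p : ℝ)⁻¹ ^ 2))) := by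
  have hcov : ∀ p ∈ P, ∀ q ∈ P, Tendsto (fun u : ℝ => Real.exp (-u) *
      ∑ n ∈ Finset.Icc 1 ⌊Real.exp u⌋₊,
        ((p : ℝ)⁻¹ - if p ∣ n then 1 else 0) * ((q : ℝ)⁻¹ - if q ∣ n then 1 else 0)) atTop
      (𝓝 (if p = q then (p : ℝ)⁻¹ - (p : ℝ)⁻¹ ^ 2 else 0)) := by
    intro p hp q hq
    have hp' := hP p hp
    have hq' := hP q hq
    have hlim := (((tendsto_exp_neg_mul_card_multiples (Nat.lcm_ne_zero hp'.ne_zero hq'.ne_zero)).sub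
      ((tendsto_exp_neg_mul_card_multiples hq'.ne_zero).const_mul (p : ℝ)⁻¹)).sub
      ((tendsto_exp_neg_mul_card_multiples hp'.ne_zero).const_mul (q : ℝ)⁻¹)).add
      ((tendsto_exp_neg_mul_card_multiples one_ne_zero).const_mul ((p : ℝ)⁻¹ * (q : ℝ)⁻¹))
    -- Divisibility by distinct primes is asymptotically uncorrelated, so only the diagonal
    -- survives.
    have hval : ((Nat.lcm p q : ℕ) : ℝ)⁻¹ - (p : ℝ)⁻¹ * (q : ℝ)⁻¹ - (q : ℝ)⁻¹ * (p : ℝ)⁻¹ +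
        (p : ℝ)⁻¹ * (q : ℝ)⁻¹ * ((1 : ℕ) : ℝ)⁻¹ =
        if p = q then (p : ℝ)⁻¹ - (p : ℝ)⁻¹ ^ 2 else 0 := by
      split_ifs with h
      · subst h
        rw [Nat.lcm_self]
        push_cast
        ring
      · rw [((Nat.coprime_primes hp' hq').2 h).lcm_eq_mul]
        push_cast
        rw [mul_inv]
        ring
    rw [hval] at hlim
    refine hlim.congr fun u => ?_
    rw [mul_left_comm, mul_left_comm (q : ℝ)⁻¹, mul_left_comm (_ * _), ← mul_sub, ← mul_sub,
      ← mul_add]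
    congr 1
    simp only [Finset.mul_sum, ← Finset.sum_sub_distrib, ← Finset.sum_add_distrib]
    refine Finset.sum_congr rfl fun n _ => ?_
    simp only [Nat.lcm_dvd_iff, one_dvd, if_true]
    by_cases h1 : p ∣ n <;> by_cases h2 : q ∣ n <;> simp [h1, h2] <;> ring
  have hsum := tendsto_finsetSum P fun p hp =>
    tendsto_finsetSum P fun q hq => (hcov p hp q hq).const_mul (c p * c q)
  have hval : ∑ p ∈ P, ∑ q ∈ P, c p * c q * (if p = q then (p : ℝ)⁻¹ - (p : ℝ)⁻¹ ^ 2 else 0) =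
      ∑ p ∈ P, c p ^ 2 * ((p : ℝ)⁻¹ - (p : ℝ)⁻¹ ^ 2) := by
    refine Finset.sum_congr rfl fun p hp => ?_
    simp only [mul_ite, mul_zero]
    rw [Finset.sum_ite_eq P p, if_pos hp]
    ring
  rw [hval] at hsum
  refine hsum.congr fun u => ?_
  simp only [mul_left_comm _ (Real.exp (-u)), ← Finset.mul_sum]
  congr 1
  simp only [pow_two (∑ p ∈ P, _), Finset.sum_mul_sum]
  conv_rhs => rw [Finset.sum_comm]
  refine Finset.sum_congr rfl fun p _ => ?_
  conv_rhs => rw [Finset.sum_comm]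
  refine Finset.sum_congr rfl fun q _ => ?_
  rw [Finset.mul_sum]
  refine Finset.sum_congr rfl fun n _ => ?_
  ring

/-- The left side is a mean of a(Ω(n)) against the centred count of prime divisors of n; bound a by
C and apply Cauchy–Schwarz. -/
theorem norm_sum_expMean_sub_le {a : ℕ → ℂ} {C : ℝ} (hC : ∀ n, ‖a n‖ ≤ C) (c : ℕ → ℝ)
    {P : Finset ℕ} (hP : ∀ p ∈ P, p.Prime) (u : ℝ) :
    ‖∑ p ∈ P, ((c p / p : ℝ) : ℂ) *
        (expMean a u - expMean (fun k => a (k + 1)) (u - Real.log p))‖ ≤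
      C * √(Real.exp (-u) * ∑ n ∈ Finset.Icc 1 ⌊Real.exp u⌋₊,
        (∑ p ∈ P, c p * ((p : ℝ)⁻¹ - if p ∣ n then 1 else 0)) ^ 2) := by
  have hC0 : 0 ≤ C := (norm_nonneg _).trans (hC 0)
  set N := ⌊Real.exp u⌋₊ with hN
  set X : ℕ → ℝ := fun n => ∑ p ∈ P, c p * ((p : ℝ)⁻¹ - if p ∣ n then 1 else 0) with hX
  have heq : ∑ p ∈ P, ((c p / p : ℝ) : ℂ) *
      (expMean a u - expMean (fun k => a (k + 1)) (u - Real.log p)) =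
      (Real.exp (-u) : ℂ) * ∑ n ∈ Finset.Icc 1 N, a (cardFactors n) * (X n : ℂ) := by
    have h1 : ∀ p ∈ P, ((c p / p : ℝ) : ℂ) *
        (expMean a u - expMean (fun k => a (k + 1)) (u - Real.log p)) =
        (Real.exp (-u) : ℂ) * ∑ n ∈ Finset.Icc 1 N, a (cardFactors n) *
          ((c p * ((p : ℝ)⁻¹ - if p ∣ n then 1 else 0) : ℝ) : ℂ) := by
      intro p hp
      have h2 : ((c p / p : ℝ) : ℂ) *
          (expMean a u - expMean (fun k => a (k + 1)) (u - Real.log p)) =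
          (c p : ℂ) * (((p : ℝ)⁻¹ : ℂ) * expMean a u -
            ((p : ℝ)⁻¹ : ℂ) * expMean (fun k => a (k + 1)) (u - Real.log p)) := by
        push_cast
        ring
      rw [h2, expMean_shift_sub_log a (hP p hp), expMean, mul_left_comm, ← mul_sub, mul_left_comm]
      congr 1
      rw [Finset.mul_sum, ← Finset.sum_sub_distrib, Finset.mul_sum]
      refine Finset.sum_congr rfl fun n _ => ?_
      split_ifs <;> push_cast <;> ring
    rw [Finset.sum_congr rfl h1, ← Finset.mul_sum, Finset.sum_comm]
    simp only [← Finset.mul_sum, ← Complex.ofReal_sum, hX]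
  rw [heq, norm_mul, Complex.norm_real, Real.norm_of_nonneg (Real.exp_pos _).le]
  have h3 : ‖∑ n ∈ Finset.Icc 1 N, a (cardFactors n) * (X n : ℂ)‖ ≤
      C * ∑ n ∈ Finset.Icc 1 N, |X n| := by
    rw [Finset.mul_sum]
    refine norm_sum_le_of_le _ fun n _ => ?_
    rw [norm_mul, Complex.norm_real, Real.norm_eq_abs]
    exact mul_le_mul_of_nonneg_right (hC _) (abs_nonneg _)
  have h4 : Real.exp (-u) * ∑ n ∈ Finset.Icc 1 N, |X n| ≤
      √(Real.exp (-u) * ∑ n ∈ Finset.Icc 1 N, X n ^ 2) := by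
    refine Real.le_sqrt_of_sq_le ?_
    have h5 := sq_sum_le_card_mul_sum_sq (s := Finset.Icc 1 N) (f := fun n => |X n|)
    simp only [sq_abs, Nat.card_Icc, Nat.add_sub_cancel] at h5
    have h6 : 0 ≤ ∑ n ∈ Finset.Icc 1 N, X n ^ 2 := Finset.sum_nonneg fun n _ => sq_nonneg _
    calc _ = Real.exp (-u) * (Real.exp (-u) * (∑ n ∈ Finset.Icc 1 N, |X n|) ^ 2) := by ring
      _ ≤ Real.exp (-u) * (Real.exp (-u) * (N * ∑ n ∈ Finset.Icc 1 N, X n ^ 2)) := by gcongr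
      _ = (Real.exp (-u) * N) * (Real.exp (-u) * ∑ n ∈ Finset.Icc 1 N, X n ^ 2) := by ring
      _ ≤ 1 * (Real.exp (-u) * ∑ n ∈ Finset.Icc 1 N, X n ^ 2) :=
          mul_le_mul_of_nonneg_right (exp_neg_mul_floor_le_one u)
            (mul_nonneg (Real.exp_pos _).le h6)
      _ = _ := one_mul _
  calc _ ≤ Real.exp (-u) * (C * ∑ n ∈ Finset.Icc 1 N, |X n|) := by gcongr
    _ = C * (Real.exp (-u) * ∑ n ∈ Finset.Icc 1 N, |X n|) := by ring
    _ ≤ _ := by gcongr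

/-! ### Ultrafilter limits and their invariance -/

section Limits

variable {U : Ultrafilter ℝ}

theorem exists_tendsto_expMean (U : Ultrafilter ℝ) {a : ℕ → ℂ} {C : ℝ} (hC : ∀ n, ‖a n‖ ≤ C) :
    ∃ G : ℝ → ℂ, ∀ s, Tendsto (fun u => expMean a (u + s)) U (𝓝 (G s)) := by
  have h : ∀ s, ∃ z, Tendsto (fun u => expMean a (u + s)) U (𝓝 z) := fun s => by
    obtain ⟨z, -, hz⟩ := (isCompact_closedBall (0 : ℂ) C).ultrafilter_le_nhds
      (U.map fun u => expMean a (u + s)) (by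
        rw [le_principal_iff]
        exact mem_map.2 (univ_mem' fun u => by simpa using norm_expMean_le hC (u + s)))
    exact ⟨z, hz⟩
  choose G hG using h
  exact ⟨G, hG⟩

theorem norm_limit_expMean_le {a : ℕ → ℂ} {C : ℝ} (hC : ∀ n, ‖a n‖ ≤ C) {G : ℝ → ℂ}
    (hG : ∀ s, Tendsto (fun u => expMean a (u + s)) U (𝓝 (G s))) (s : ℝ) : ‖G s‖ ≤ C :=
  le_of_tendsto (hG s).norm (Eventually.of_forall fun _ => norm_expMean_le hC _)

theorem norm_limit_expMean_sub_le (hU : (U : Filter ℝ) ≤ atTop) {a : ℕ → ℂ} {C : ℝ}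
    (hC : ∀ n, ‖a n‖ ≤ C) {G : ℝ → ℂ}
    (hG : ∀ s, Tendsto (fun u => expMean a (u + s)) U (𝓝 (G s))) (x y : ℝ) :
    ‖G x - G y‖ ≤ 2 * C * |x - y| := by
  have key : ∀ x y : ℝ, y ≤ x → ‖G x - G y‖ ≤ 2 * C * |x - y| := fun x y hxy => by
    have h1 : Tendsto (fun u => C * (2 * (x - y) + Real.exp (-(u + x)))) U
        (𝓝 (C * (2 * (x - y) + 0))) := by
      refine Tendsto.const_mul _ (Tendsto.const_add _ ?_)
      exact (Real.tendsto_exp_neg_atTop_nhds_zero.comp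
        (tendsto_atTop_add_const_right _ x tendsto_id)).mono_left hU
    refine (le_of_tendsto_of_tendsto' ((hG x).sub (hG y)).norm h1 fun u => ?_).trans (le_of_eq ?_)
    · simpa using norm_expMean_sub_le hC (by linarith : u + y ≤ u + x)
    · rw [abs_of_nonneg (by linarith)]
      ring
  rcases le_total y x with h | h
  · exact key x y h
  · rw [norm_sub_rev, abs_sub_comm]
    exact key y x h

/-- Passing to the limit replaces the empirical variance by its asymptotic value, from which the
negative 1/p² terms are dropped. -/
theorem norm_sum_limit_expMean_sub_le (hU : (U : Filter ℝ) ≤ atTop) {a : ℕ → ℂ} {C : ℝ}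
    (hC : ∀ n, ‖a n‖ ≤ C) {G G' : ℝ → ℂ}
    (hG : ∀ s, Tendsto (fun u => expMean a (u + s)) U (𝓝 (G s)))
    (hG' : ∀ s, Tendsto (fun u => expMean (fun k => a (k + 1)) (u + s)) U (𝓝 (G' s)))
    (c : ℕ → ℝ) {P : Finset ℕ} (hP : ∀ p ∈ P, p.Prime) (s : ℝ) :
    ‖∑ p ∈ P, ((c p / p : ℝ) : ℂ) * (G s - G' (s - Real.log p))‖ ≤
      C * √(∑ p ∈ P, c p ^ 2 / p) := by
  have hC0 : 0 ≤ C := (norm_nonneg _).trans (hC 0)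
  have h1 : Tendsto (fun u => ∑ p ∈ P, ((c p / p : ℝ) : ℂ) *
      (expMean a (u + s) - expMean (fun k => a (k + 1)) (u + s - Real.log p))) U
      (𝓝 (∑ p ∈ P, ((c p / p : ℝ) : ℂ) * (G s - G' (s - Real.log p)))) := by
    refine tendsto_finsetSum P fun p _ => ((hG s).sub ?_).const_mul _
    simpa only [add_sub_assoc] using hG' (s - Real.log p)
  have h2 := ((((tendsto_turan_kubilius_variance c hP).comp
    (tendsto_atTop_add_const_right _ s tendsto_id)).mono_left hU).sqrt).const_mul C
  refine (le_of_tendsto_of_tendsto' h1.norm h2 fun u =>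
    norm_sum_expMean_sub_le hC c hP (u + s)).trans ?_
  gcongr with p hp
  rw [div_eq_mul_inv]
  gcongr
  simp

theorem norm_tsum_limit_expMean_sub_le (hU : (U : Filter ℝ) ≤ atTop) {a : ℕ → ℂ} {C : ℝ}
    (hC : ∀ n, ‖a n‖ ≤ C) {G G' : ℝ → ℂ}
    (hG : ∀ s, Tendsto (fun u => expMean a (u + s)) U (𝓝 (G s)))
    (hG' : ∀ s, Tendsto (fun u => expMean (fun k => a (k + 1)) (u + s)) U (𝓝 (G' s)))
    {c : ℕ → ℝ} (hc : ∀ n, ¬ n.Prime → c n = 0) (hc0 : ∀ n, 0 ≤ c n)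
    (hcs : Summable fun n => c n / n) (hcs2 : Summable fun n => c n ^ 2 / n) (s : ℝ) :
    Summable (fun n : ℕ => ((c n / n : ℝ) : ℂ) * (G s - G' (s - Real.log n))) ∧
    ‖∑' n : ℕ, ((c n / n : ℝ) : ℂ) * (G s - G' (s - Real.log n))‖ ≤
      C * √(∑' n, c n ^ 2 / n) := by
  have hC0 : 0 ≤ C := (norm_nonneg _).trans (hC 0)
  have hs : Summable (fun n : ℕ => ((c n / n : ℝ) : ℂ) * (G s - G' (s - Real.log n))) := by
    refine Summable.of_norm_bounded (hcs.mul_right (C + C)) fun n => ?_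
    have h0 : 0 ≤ c n / n := div_nonneg (hc0 n) n.cast_nonneg
    rw [norm_mul, Complex.norm_real, Real.norm_of_nonneg h0]
    exact mul_le_mul_of_nonneg_left ((norm_sub_le _ _).trans (add_le_add
      (norm_limit_expMean_le hC hG _) (norm_limit_expMean_le (fun n => hC (n + 1)) hG' _))) h0
  refine ⟨hs, le_of_tendsto hs.hasSum.norm (Eventually.of_forall fun T => ?_)⟩
  have h1 : ∑ n ∈ T, ((c n / n : ℝ) : ℂ) * (G s - G' (s - Real.log n)) =
      ∑ n ∈ T.filter Nat.Prime, ((c n / n : ℝ) : ℂ) * (G s - G' (s - Real.log n)) := by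
    rw [Finset.sum_filter]
    refine Finset.sum_congr rfl fun n _ => ?_
    split_ifs with hn
    · rfl
    · simp [hc n hn]
  rw [h1]
  refine (norm_sum_limit_expMean_sub_le hU hC hG hG' c
    (fun p hp => (Finset.mem_filter.1 hp).2) s).trans ?_
  gcongr
  exact hcs2.sum_le_tsum _ fun n _ => by positivity

/-- Limits of the means of `a ∘ Ω` do not depend on the scale. -/
theorem limit_expMean_eq (hU : (U : Filter ℝ) ≤ atTop) {a : ℕ → ℂ} {C : ℝ}
    (hC : ∀ n, ‖a n‖ ≤ C) {G : ℝ → ℂ}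
    (hG : ∀ s, Tendsto (fun u => expMean a (u + s)) U (𝓝 (G s))) (s t : ℝ) : G s = G t := by
  have hC0 : 0 ≤ C := (norm_nonneg _).trans (hC 0)
  have hC' : ∀ n, ‖a (n + 1)‖ ≤ C := fun n => hC (n + 1)
  obtain ⟨G', hG'⟩ := exists_tendsto_expMean U hC'
  -- The sums of G' at s - log p and t - log p differ by the translation defect of x ↦ G'(s - x)
  -- with shift s - t. The outer 2 comes from total mass at least 1/2.
  have key : ∀ ε : ℝ, 0 < ε → ‖G s - G t‖ ≤ 2 * (2 * (C * √ε) + ε) := fun ε hε => by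
    obtain ⟨c, hc, hc0, hcs, hc1, hcs2, hc2, hc3⟩ := exists_prime_weights
      (g := fun x => G' (s - x)) (C := C) (L := 2 * C)
      (fun x => norm_limit_expMean_le hC' hG' _)
      (fun x y => (norm_limit_expMean_sub_le hU hC' hG' _ _).trans
        (by rw [sub_sub_sub_cancel_left, abs_sub_comm])) (s - t) hε
    obtain ⟨hs1, hs2⟩ := norm_tsum_limit_expMean_sub_le hU hC hG hG' hc hc0 hcs hcs2 s
    obtain ⟨ht1, ht2⟩ := norm_tsum_limit_expMean_sub_le hU hC hG hG' hc hc0 hcs hcs2 t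
    have hb : C * √(∑' n, c n ^ 2 / n) ≤ C * √ε := by gcongr
    set W := ∑' n, c n / n with hW
    have hWs : Summable fun n : ℕ => ((c n / n : ℝ) : ℂ) * (G s - G t) :=
      (Complex.summable_ofReal.2 hcs).mul_right _
    have hsum3 := hWs.sub (hs1.sub ht1)
    have heq : (W : ℂ) * (G s - G t) =
        (∑' n : ℕ, ((c n / n : ℝ) : ℂ) * (G s - G' (s - Real.log n)) -
          ∑' n : ℕ, ((c n / n : ℝ) : ℂ) * (G t - G' (t - Real.log n))) +
        ∑' n : ℕ, ((c n / n : ℝ) : ℂ) * (G' (s - Real.log n) - G' (s - (Real.log n + (s - t)))) := by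
      rw [hW, Complex.ofReal_tsum, ← tsum_mul_right, ← hs1.tsum_sub ht1]
      have : ∀ n : ℕ, ((c n / n : ℝ) : ℂ) *
          (G' (s - Real.log n) - G' (s - (Real.log n + (s - t)))) =
          ((c n / n : ℝ) : ℂ) * (G s - G t) -
          (((c n / n : ℝ) : ℂ) * (G s - G' (s - Real.log n)) -
            ((c n / n : ℝ) : ℂ) * (G t - G' (t - Real.log n))) := fun n => by
        rw [show s - (Real.log n + (s - t)) = t - Real.log n by ring]
        ring
      simp only [this]
      rw [hWs.tsum_sub (hs1.sub ht1)]
      ring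
    have h1 : W * ‖G s - G t‖ ≤ 2 * (C * √ε) + ε := by
      have : ‖(W : ℂ) * (G s - G t)‖ = W * ‖G s - G t‖ := by
        rw [norm_mul, Complex.norm_real, Real.norm_of_nonneg (by linarith)]
      rw [← this, heq]
      refine (norm_add_le _ _).trans (add_le_add ((norm_sub_le _ _).trans ?_) hc3)
      linarith
    nlinarith [norm_nonneg (G s - G t)]
  have hlim : Tendsto (fun ε : ℝ => 2 * (2 * (C * √ε) + ε)) (𝓝[>] 0) (𝓝 0) := by
    have : Continuous (fun ε : ℝ => 2 * (2 * (C * √ε) + ε)) := by fun_prop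
    simpa using (this.tendsto 0).mono_left nhdsWithin_le_nhds
  have := ge_of_tendsto hlim (by filter_upwards [self_mem_nhdsWithin] with ε hε using key ε hε)
  exact sub_eq_zero.1 (norm_le_zero_iff.1 this)

/-- Limits of the means of `a ∘ Ω` are invariant under shifting `a`. -/
theorem limit_expMean_shift_eq (hU : (U : Filter ℝ) ≤ atTop) {a : ℕ → ℂ} {C : ℝ}
    (hC : ∀ n, ‖a n‖ ≤ C) {G G' : ℝ → ℂ}
    (hG : ∀ s, Tendsto (fun u => expMean a (u + s)) U (𝓝 (G s)))
    (hG' : ∀ s, Tendsto (fun u => expMean (fun k => a (k + 1)) (u + s)) U (𝓝 (G' s))) (s : ℝ) :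
    G s = G' s := by
  have hC0 : 0 ≤ C := (norm_nonneg _).trans (hC 0)
  have hC' : ∀ n, ‖a (n + 1)‖ ≤ C := fun n => hC (n + 1)
  have key : ∀ ε : ℝ, 0 < ε → ‖G s - G' s‖ ≤ 2 * (C * √ε) := fun ε hε => by
    -- Since G' is constant, only the mass and second-moment bounds matter, so the test function is
    -- taken to be 0.
    obtain ⟨c, hc, hc0, hcs, hc1, hcs2, hc2, -⟩ := exists_prime_weights
      (g := fun _ => 0) (C := 0) (L := 0) (by simp) (by simp) 0 hε
    obtain ⟨-, hs2⟩ := norm_tsum_limit_expMean_sub_le hU hC hG hG' hc hc0 hcs hcs2 s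
    have hb : C * √(∑' n, c n ^ 2 / n) ≤ C * √ε := by gcongr
    simp only [fun n : ℕ => limit_expMean_eq hU hC' hG' (s - Real.log n) s] at hs2
    rw [tsum_mul_right, ← Complex.ofReal_tsum, norm_mul, Complex.norm_real,
      Real.norm_of_nonneg (by linarith)] at hs2
    nlinarith [norm_nonneg (G s - G' s)]
  have hlim : Tendsto (fun ε : ℝ => 2 * (C * √ε)) (𝓝[>] 0) (𝓝 0) := by
    have : Continuous (fun ε : ℝ => 2 * (C * √ε)) := by fun_prop
    simpa using (this.tendsto 0).mono_left nhdsWithin_le_nhds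
  have := ge_of_tendsto hlim (by filter_upwards [self_mem_nhdsWithin] with ε hε using key ε hε)
  exact sub_eq_zero.1 (norm_le_zero_iff.1 this)

end Limits

/-! ### From shift invariance to the limit theorem -/

theorem sum_Icc_add_left (g : ℕ → ℂ) (M K : ℕ) :
    ∑ k ∈ Finset.Icc (M + 1) (M + K), g k = ∑ k ∈ Finset.Icc 1 K, g (M + k) := by
  rw [← Finset.map_add_left_Icc, Finset.sum_map]
  simp

theorem tendsto_expMean_zero {a : ℕ → ℂ} {C : ℝ} (hC : ∀ n, ‖a n‖ ≤ C)
    (ha : TendstoUniformly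
      (fun (K M : ℕ) => (1 / (K : ℂ)) * ∑ k ∈ Finset.Icc (M + 1) (M + K), a k)
      (fun _ => 0) atTop) :
    Tendsto (expMean a) atTop (𝓝 0) := by
  rw [tendsto_iff_ultrafilter]
  intro U hU
  have hCk : ∀ k n, ‖a (n + k)‖ ≤ C := fun k n => hC (n + k)
  choose G hG using fun k => exists_tendsto_expMean U (hCk k)
  have hshift : ∀ k, G k 0 = G 0 0 := fun k => by
    induction k with
    | zero => rfl
    | succ k ih =>
      rw [← ih]
      refine (limit_expMean_shift_eq hU (hCk k) (hG k) (fun s => ?_) 0).symm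
      have := hG (k + 1) s
      simpa only [add_assoc, add_comm 1 k] using this
  have hlim : ∀ k, Tendsto (expMean fun n => a (n + k)) U (𝓝 (G 0 0)) := fun k => by
    have := hG k 0
    rw [hshift] at this
    simpa only [add_zero] using this
  have hG0 : G 0 0 = 0 := by
    rw [← norm_le_zero_iff]
    refine le_of_forall_pos_le_add fun ε hε => ?_
    rw [zero_add]
    obtain ⟨K, hK, hK0⟩ := ((Metric.tendstoUniformly_iff.1 ha ε hε).and (eventually_gt_atTop 0)).exists
    have hKC : (K : ℂ) ≠ 0 := by exact_mod_cast hK0.ne'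
    set b : ℕ → ℂ := fun M => (1 / (K : ℂ)) * ∑ k ∈ Finset.Icc (M + 1) (M + K), a k with hb
    -- The mean of b ∘ Ω is at most ε, yet it is the average of K means of shifts of a, all with the
    -- same limit.
    have hbε : ∀ M, ‖b M‖ ≤ ε := fun M => by simpa [hb] using (hK M).le
    have hbexp : ∀ u, expMean b u =
        (1 / (K : ℂ)) * ∑ k ∈ Finset.Icc 1 K, expMean (fun n => a (n + k)) u := fun u => by
      have h1 : ∀ M, b M = (1 / (K : ℂ)) * ∑ k ∈ Finset.Icc 1 K, a (M + k) := fun M => by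
        simp only [hb, sum_Icc_add_left]
      simp only [expMean, h1, ← Finset.mul_sum]
      rw [mul_left_comm, Finset.sum_comm]
    have h2 : Tendsto (expMean b) U (𝓝 ((1 / (K : ℂ)) * ∑ k ∈ Finset.Icc 1 K, G 0 0)) := by
      refine Tendsto.congr (fun u => (hbexp u).symm) ?_
      exact (tendsto_finsetSum _ fun k _ => hlim k).const_mul _
    rw [Finset.sum_const, Nat.card_Icc, Nat.add_sub_cancel, nsmul_eq_mul, ← mul_assoc,
      one_div_mul_cancel hKC, one_mul] at h2
    exact le_of_tendsto h2.norm (Eventually.of_forall fun u => norm_expMean_le hbε u)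
  rw [← hG0]
  exact hlim 0

theorem tendsto_mean_comp_cardFactors {a : ℕ → ℂ} {C : ℝ} (hC : ∀ n, ‖a n‖ ≤ C)
    (ha : TendstoUniformly
      (fun (K M : ℕ) => (1 / (K : ℂ)) * ∑ k ∈ Finset.Icc (M + 1) (M + K), a k)
      (fun _ => 0) atTop) :
    Tendsto (fun N : ℕ => (1 / (N : ℂ)) * ∑ n ∈ Finset.Icc 1 N, a (cardFactors n))
      atTop (𝓝 0) := by
  refine ((tendsto_expMean_zero hC ha).comp
    (Real.tendsto_log_atTop.comp tendsto_natCast_atTop_atTop)).congr' ?_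
  filter_upwards [eventually_gt_atTop 0] with N hN
  have hN' : (0 : ℝ) < N := by exact_mod_cast hN
  simp only [Function.comp, expMean]
  rw [Real.exp_neg, Real.exp_log hN', Nat.floor_natCast]
  push_cast
  rw [one_div]

/-! ### Orbits of a transformation -/

/-- A function with uniformly small ergodic averages is bounded along every orbit. -/
theorem exists_bound_of_tendstoUniformly_mean {X : Type*} {T : X → X} {f : X → ℂ}
    (hf : TendstoUniformly
      (fun (N : ℕ) (x : X) => (1 / (N : ℂ)) * ∑ n ∈ Finset.Icc 1 N, f (T^[n] x))
      (fun _ => 0) atTop) (x : X) :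
    ∃ C : ℝ, ∀ n : ℕ, ‖f (T^[n] x)‖ ≤ C := by
  obtain ⟨N₀, hN₀⟩ := eventually_atTop.1 (Metric.tendstoUniformly_iff.1 hf 1 one_pos)
  set N := N₀ + 1 with hN
  have hsum : ∀ M : ℕ, N₀ ≤ M → 0 < M → ∀ y, ‖∑ n ∈ Finset.Icc 1 M, f (T^[n] y)‖ ≤ M := by
    intro M hM hM0 y
    have h := (hN₀ M hM y).le
    have hM' : (0 : ℝ) < M := by exact_mod_cast hM0
    rw [dist_zero_left, norm_mul, norm_div, norm_one, Complex.norm_natCast, one_div_mul_eq_div,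
      div_le_one hM'] at h
    exact h
  -- One value of f is the difference of two consecutive orbit sums, each bounded by its length.
  -- This bounds f on the image of T^(N+1); only finitely many points of the orbit remain.
  have hbig : ∀ y, ‖f (T^[N + 1] y)‖ ≤ (N + 1 : ℕ) + N := fun y => by
    have h1 := hsum (N + 1) (by omega) (by omega) y
    have h2 := hsum N (by omega) (by omega) y
    rw [Finset.sum_Icc_succ_top (by omega)] at h1
    calc _ = ‖(∑ n ∈ Finset.Icc 1 N, f (T^[n] y) + f (T^[N + 1] y)) -
          ∑ n ∈ Finset.Icc 1 N, f (T^[n] y)‖ := by simp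
      _ ≤ _ := (norm_sub_le _ _).trans (add_le_add h1 h2)
  refine ⟨((N + 1 : ℕ) + N) + ∑ n ∈ Finset.range (N + 1), ‖f (T^[n] x)‖, fun n => ?_⟩
  rcases lt_or_ge n (N + 1) with hn | hn
  · have := Finset.single_le_sum (f := fun n => ‖f (T^[n] x)‖) (fun i _ => norm_nonneg _)
      (Finset.mem_range.2 hn)
    have h0 : (0 : ℝ) ≤ (N + 1 : ℕ) + N := by positivity
    linarith
  · obtain ⟨m, rfl⟩ := Nat.exists_eq_add_of_le hn
    have := hbig (T^[m] x)
    rw [← Function.iterate_add_apply] at this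
    have h0 : 0 ≤ ∑ n ∈ Finset.range (N + 1), ‖f (T^[n] x)‖ :=
      Finset.sum_nonneg fun i _ => norm_nonneg _
    linarith

/-- An interval starting after M is an orbit segment starting at T^M x. -/
theorem tendstoUniformly_orbit_mean {X : Type*} {T : X → X} {f : X → ℂ}
    (hf : TendstoUniformly
      (fun (N : ℕ) (x : X) => (1 / (N : ℂ)) * ∑ n ∈ Finset.Icc 1 N, f (T^[n] x))
      (fun _ => 0) atTop) (x : X) :
    TendstoUniformly
      (fun (K M : ℕ) => (1 / (K : ℂ)) * ∑ k ∈ Finset.Icc (M + 1) (M + K), f (T^[k] x))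
      (fun _ => 0) atTop := by
  have h := hf.comp fun M : ℕ => T^[M] x
  have hshift : ∀ M k : ℕ, f (T^[M + k] x) = f (T^[k] (T^[M] x)) := fun M k => by
    rw [add_comm, Function.iterate_add_apply]
  simp only [sum_Icc_add_left (fun k => f (T^[k] x)), hshift]
  exact h

end

theorem mainTheorem8 :
    -- bounded arithmetic functions whose averages over intervals tend to zero uniformly
    (∀ a : ℕ → ℂ, (∃ C : ℝ, ∀ n : ℕ, ‖a n‖ ≤ C) →
      TendstoUniformly
        (fun (K M : ℕ) => (1 / (K : ℂ)) * ∑ k ∈ Finset.Icc (M + 1) (M + K), a k)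
        (fun _ => 0) atTop →
      Tendsto
        (fun N : ℕ => (1 / (N : ℂ)) *
          ∑ n ∈ Finset.Icc 1 N, a (ArithmeticFunction.cardFactors n))
        atTop (𝓝 0)) ∧
    -- ergodic systems and functions whose ergodic averages tend to zero uniformly
    (∀ (X : Type*) [MetricSpace X] [CompactSpace X] [MeasurableSpace X] [BorelSpace X]
      (μ : Measure X) [IsProbabilityMeasure μ] (T : X → X), Ergodic T μ →
      ∀ f : X → ℂ,
        TendstoUniformly
          (fun (N : ℕ) (x : X) => (1 / (N : ℂ)) * ∑ n ∈ Finset.Icc 1 N, f (T^[n] x))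
          (fun _ => 0) atTop →
        ∀ x : X, Tendsto
          (fun N : ℕ => (1 / (N : ℂ)) *
            ∑ n ∈ Finset.Icc 1 N, f (T^[ArithmeticFunction.cardFactors n] x))
          atTop (𝓝 0)) := by
  constructor
  · intro a ha0 ha
    obtain ⟨C, hC⟩ := ha0
    exact tendsto_mean_comp_cardFactors hC ha
  · intro X _ _ _ _ μ _ T _ f hf x
    obtain ⟨C, hC⟩ := exists_bound_of_tendstoUniformly_mean hf x
    exact tendsto_mean_comp_cardFactors (a := fun n => f (T^[n] x)) hC
      (tendstoUniformly_orbit_mean hf x)
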